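/- **Model.** A network is an $n$-vertex graph $G=(V,E)$ whose vertices carry distinct identity numbers from $\{1,\dots,n\}$. Deterministic algorithms proceed in synchronous rounds; in each round every vertex sends a message of arbitrary size to its neighbours, and local computation is free. Initially a vertex knows its own identity number and the global parameters of the algorithm ($n$, the arboricity and $p$). The running time is the number of rounds. The arboricity $a(G)$ is the least number of edge-disjoint forests that cover $E$. Logarithms are to base $2$. **Subroutines.** Fix $\varepsilon>0$. Call the following three kinds of distributed subroutines *admissible*, if their $O$-constants are uniform in all parameters ($n\ge 2$): (i) on a graph of arboricity at most $\alpha\ge1$, computing in $O(\log n)$ rounds a partition $V=H_1\cup\dots\cup H_\ell$, $\ell=O(\log n)$, such that each $v\in H_i$ has at most $\lfloor(2+\varepsilon)\alpha\rfloor$ neighbours in $\bigcup_{j\ge i}H_j$; (ii) on a graph of maximum degree at most $\Delta$, for $q\ge 1$, computing in $O(\log n)$ rounds a coloring with $O(q^2)$ colors in which each vertex has at most $\lfloor\Delta/q\rfloor$ neighbours of its own color; (iii) on a graph of arboricity at most $\alpha\ge1$, computing in $O(\alpha\log n)$ rounds a legal coloring with $\lfloor(2+\varepsilon)\alpha\rfloor+1$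 colors. **Procedure Arbdefective-Coloring** with parameters $k,t$ on a graph of arboricity at most $\alpha$: compute a partition $H_1,\dots,H_\ell$ by (i); compute in parallel an $\lfloor\alpha/t\rfloor$-defective $O(t^2)$-coloring of each $G(H_i)$ by (ii), with $\Delta=\lfloor(2+\varepsilon)\alpha\rfloor$ and $q=\lceil(2+\varepsilon)t\rceil$; orient every edge between different $H$-sets towards the set of greater index, and every edge inside an $H$-set with endpoints of different colors towards the greater color (other edges stay unoriented); then every vertex waits until all its parents (the neighbours towards which its edges are oriented) have selected a color, and selects a color from $\{1,\dots,k\}$ that is used by the minimum number of its parents. **Procedure Legal-Coloring**$(G,p)$: start with the single subgraph $G_1=G$ and $\alpha:=a(G)$. While $\alpha>p$, apply in parallel Arbdefective-Coloring with $k=t=p$ to all current subgraphs $G_i$, replace each $G_i$ by the $p$ subgraphs induced by its color classes $j=1,\dots,p$, with the indices $(i-1)p+j$, and set $\alpha:=\lfloor\alpha/p+(2+\varepsilon)\alpha/p\rfloor$. Finally, with $A=\lfloor(2+\varepsilon)\alpha\rfloor+1$, color all $G_i$ in parallel legally by (iii), using the palette $\{(i-1)A+1,\dots,iA\}$ for $G_i$.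 **Theorem.** For every $\varepsilon>0$, admissible subroutines exist, and for any admissible subroutines there is a constant $C$ such that the following holds. Let $f:\mathbb N\to\mathbb R$ be any function with $f(a)\to\infty$ (i.e. $f=\omega(1)$, growing arbitrarily slowly). Then there is a function $g$ with $g(a)\to0$ as $a\to\infty$ such that for all sufficiently large $a$ and every network $G$ of arboricity $a$ with any number $n$ of vertices, Procedure Legal-Coloring$(G,p)$ with $p=\lfloor f(a)^{1/2}\rfloor$ runs for at most $C\,f(a)\,\log a\,\log n$ rounds and computes a legal coloring of $G$ with colors from $\{1,\dots,\lfloor a^{1+g(a)}\rfloor\}$; that is, it takes $O(f(a)\log a\log n)$ time and uses $a^{1+o(1)}$ colors. -/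

import Mathlib

open Filter Topology

noncomputable section

namespace Dist

/-! ### Synchronous message passing -/

/-- A vertex program that runs for exactly `T` rounds and ends with an output in `O`.
In every round the vertex sends a message to all its neighbours, receives the messages that
its neighbours sent in this round, and continues accordingly. A message is a natural number
of arbitrary size, which may encode any finite data, such as the identity of the sender.
Local computation is free. -/
def Prog (O : Type) : ℕ → Type
  | 0 => O
  | T + 1 => ℕ × (Multiset ℕ → Prog O T)

/-- Run the program `p`, then the program `k o`, where `o` is the output of `p`. -/
def Prog.bind {O O' : Type} {T' : ℕ} :
    (T : ℕ) → Prog O T → (O → Prog O' T') → Prog O' (T' + T)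
  | 0, o, k => k o
  | T + 1, p, k => (p.1, fun M => Prog.bind T (p.2 M) k)

/-- Run a program inside the subgraph induced by the vertices that carry the label `c`: every
message is tagged with the label of its sender, and messages with other tags are dropped. -/
def Prog.within {O : Type} (c : ℕ) : (T : ℕ) → Prog O T → Prog O T
  | 0, o => o
  | T + 1, p => (Nat.pair c p.1, fun M =>
      Prog.within c T (p.2 ((M.filter fun m => m.unpair.1 = c).map fun m => m.unpair.2)))

open Classical in
/-- Outputs of all vertices of the network `G` when each vertex `v` runs the program `P v`. -/
def exec {V : Type} [Fintype V] (G : SimpleGraph V) {O : Type} :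
    (T : ℕ) → (V → Prog O T) → V → O
  | 0, P => P
  | T + 1, P => exec G T fun v =>
      (P v).2 ((Finset.univ.filter fun u => G.Adj v u).val.map fun u => (P u).1)

/-- A deterministic distributed algorithm: all vertices run the same program, started on their
local inputs, for `rounds` rounds. -/
structure Algorithm (I O : Type) where
  rounds : ℕ
  prog : I → Prog O rounds

namespace Algorithm

variable {I J O : Type}

/-- The outputs of the vertices of `G` on the local inputs `x`. -/
def run (A : Algorithm I O) {V : Type} [Fintype V] (G : SimpleGraph V) (x : V → I) : V → O :=
  exec G A.rounds fun v => A.prog (x v)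

/-- Local preprocessing of the input (no communication). -/
def comap (g : J → I) (A : Algorithm I O) : Algorithm J O := ⟨A.rounds, fun j => A.prog (g j)⟩

/-- A local computation (no communication). -/
def ofFun (g : I → O) : Algorithm I O := ⟨0, g⟩

/-- Run `A`, and then `B`, which gets the input and the output of `A`. -/
def seq (A : Algorithm I J) (B : Algorithm (I × J) O) : Algorithm I O :=
  ⟨B.rounds + A.rounds, fun i => Prog.bind A.rounds (A.prog i) fun j => B.prog (i, j)⟩

/-- Run `A` in parallel on all the subgraphs induced by the classes of a labelling of the
vertices. The first component of the input is the label of the vertex. -/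
def within (A : Algorithm I O) : Algorithm (ℕ × I) O :=
  ⟨A.rounds, fun x => Prog.within x.1 A.rounds (A.prog x.2)⟩

end Algorithm

/-- The vertices carry distinct identity numbers from `{1, …, n}`, where `n = |V|`. -/
def IsIdentity {V : Type} [Fintype V] (ident : V → ℕ) : Prop :=
  Function.Injective ident ∧ ∀ v, 1 ≤ ident v ∧ ident v ≤ Fintype.card V

/-- The least number of edge-disjoint forests that cover the edges of `G`. -/
def arboricity {V : Type} (G : SimpleGraph V) : ℕ :=
  sInf {k | ∃ F : Fin k → SimpleGraph V, (∀ i, (F i).IsAcyclic) ∧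
    (Pairwise fun i j => Disjoint (F i) (F j)) ∧ ⨆ i, F i = G}

/-! ### The basic subroutines

The procedure is built on three basic subroutines. In all of them `n` is the number of vertices,
the local input of a vertex is its identity number, and the output is a natural number. -/

structure Subroutines where
  /-- Computes an `H`-partition of a graph of arboricity at most `α`; the output is the
  `H`-index. -/
  hPartition (n α : ℕ) : Algorithm ℕ ℕ
  /-- The number of sets of the `H`-partition. -/
  hCount (n α : ℕ) : ℕ
  /-- Computes a `⌊Δ / q⌋`-defective coloring of a graph of maximum degree at most `Δ`. -/
  defective (n Δ q : ℕ) : Algorithm ℕ ℕ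
  /-- The number of colors of the defective coloring. -/
  defectiveCount (n Δ q : ℕ) : ℕ
  /-- Computes a legal coloring of a graph of arboricity at most `α`. -/
  legal (n α : ℕ) : Algorithm ℕ ℕ

open Classical in
/-- The subroutines do what they should, with the constants `ε` and `c`:
* the `H`-partition has `O(log n)` sets `H_1, H_2, …` and is computed in `O(log n)` rounds, and a
  vertex of `H_i` has at most `⌊(2 + ε) α⌋` neighbours in the union of the `H_j` with `j ≥ i`;
* the `⌊Δ / q⌋`-defective coloring has `O(q²)` colors and is computed in `O(log n)` rounds;
* the legal coloring has `⌊(2 + ε) α⌋ + 1` colors and is computed in `O(α log n)` rounds. -/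
structure Subroutines.Admissible (S : Subroutines) (ε c : ℝ) : Prop where
  hPartition_spec : ∀ (V : Type) [Fintype V] (G : SimpleGraph V) (ident : V → ℕ) (α : ℕ),
    2 ≤ Fintype.card V → IsIdentity ident → 1 ≤ α → arboricity G ≤ α →
    ∀ v, 1 ≤ (S.hPartition (Fintype.card V) α).run G ident v ∧
      (S.hPartition (Fintype.card V) α).run G ident v ≤ S.hCount (Fintype.card V) α ∧
      (Finset.univ.filter fun u => G.Adj v u ∧
        (S.hPartition (Fintype.card V) α).run G ident v ≤
          (S.hPartition (Fintype.card V) α).run G ident u).card ≤ ⌊(2 + ε) * α⌋₊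
  hPartition_bounds : ∀ n α : ℕ, 2 ≤ n → 1 ≤ α →
    (S.hCount n α : ℝ) ≤ c * Real.logb 2 n ∧
    ((S.hPartition n α).rounds : ℝ) ≤ c * Real.logb 2 n
  defective_spec : ∀ (V : Type) [Fintype V] (G : SimpleGraph V) (ident : V → ℕ) (Δ q : ℕ),
    2 ≤ Fintype.card V → IsIdentity ident → 1 ≤ q →
    (∀ v, (Finset.univ.filter fun u => G.Adj v u).card ≤ Δ) →
    ∀ v, 1 ≤ (S.defective (Fintype.card V) Δ q).run G ident v ∧
      (S.defective (Fintype.card V) Δ q).run G ident v ≤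
        S.defectiveCount (Fintype.card V) Δ q ∧
      (Finset.univ.filter fun u => G.Adj v u ∧
        (S.defective (Fintype.card V) Δ q).run G ident u =
          (S.defective (Fintype.card V) Δ q).run G ident v).card ≤ Δ / q
  defective_bounds : ∀ n Δ q : ℕ, 2 ≤ n → 1 ≤ q →
    (S.defectiveCount n Δ q : ℝ) ≤ c * q ^ 2 ∧
    ((S.defective n Δ q).rounds : ℝ) ≤ c * Real.logb 2 n
  legal_spec : ∀ (V : Type) [Fintype V] (G : SimpleGraph V) (ident : V → ℕ) (α : ℕ),
    2 ≤ Fintype.card V → IsIdentity ident → 1 ≤ α → arboricity G ≤ α →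
    (∀ v, 1 ≤ (S.legal (Fintype.card V) α).run G ident v ∧
      (S.legal (Fintype.card V) α).run G ident v ≤ ⌊(2 + ε) * α⌋₊ + 1) ∧
    ∀ u v, G.Adj u v →
      (S.legal (Fintype.card V) α).run G ident u ≠ (S.legal (Fintype.card V) α).run G ident v
  legal_bounds : ∀ n α : ℕ, 2 ≤ n → 1 ≤ α →
    ((S.legal n α).rounds : ℝ) ≤ c * α * Real.logb 2 n

/-! ### Procedure Partial-Orientation -/

/-- One round, in which every vertex tells its neighbours its identity, its `H`-index `h` and its
color `φ`. An edge between different `H`-sets is oriented towards the set with the greater index,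
an edge inside an `H`-set towards the greater color; edges inside an `H`-set with endpoints of
equal color stay unoriented. The output is the set of the identities of the parents, i.e. of the
neighbours towards which an edge is oriented. -/
def orient : Algorithm ((ℕ × ℕ) × ℕ) (Finset ℕ) where
  rounds := 1
  prog x :=
    (Nat.pair x.1.1 (Nat.pair x.1.2 x.2), fun M =>
      ((M.filter fun m =>
        x.1.2 < m.unpair.2.unpair.1 ∨
          (x.1.2 = m.unpair.2.unpair.1 ∧ x.2 < m.unpair.2.unpair.2)).map
        fun m => m.unpair.1).toFinset)

/-- The parameter `q` for which a `⌊Δ / q⌋`-defective coloring of the sets of the `H`-partition,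
which have maximum degree at most `Δ = ⌊(2 + ε) α⌋`, is `⌊α / t⌋`-defective. -/
def defectParam (ε : ℝ) (t : ℕ) : ℕ := ⌈(2 + ε) * t⌉₊

/-- Procedure Partial-Orientation on a graph of arboricity at most `α`, with parameter `t`:
an `H`-partition, then an `⌊α / t⌋`-defective `O(t²)`-coloring of all the `H`-sets in parallel,
then the orientation. -/
def partialOrientation (ε : ℝ) (S : Subroutines) (n α t : ℕ) : Algorithm ℕ (Finset ℕ) :=
  (S.hPartition n α).seq
    (((S.defective n ⌊(2 + ε) * α⌋₊ (defectParam ε t)).within.comap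
      fun x : ℕ × ℕ => (x.2, x.1)).seq orient)

/-- Upper bound on the number of vertices of a directed path of the partial orientation: the
number of `H`-sets times the number of colors. -/
def pathBound (ε : ℝ) (S : Subroutines) (n α t : ℕ) : ℕ :=
  S.hCount n α * S.defectiveCount n ⌊(2 + ε) * α⌋₊ (defectParam ε t)

/-! ### Procedure Simple-Arbdefective -/

/-- The least color in `{1, …, k}` among those that occur least often in `cs`. -/
def leastUsed (k : ℕ) (cs : Multiset ℕ) : ℕ :=
  ((List.range' 1 k).argmin fun i => cs.count i).getD 1

/-- What a vertex selects after it has received the messages `M`, each of which consists of the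
identity of the sender and its selection (`0` if it has not selected yet): a vertex that has not
selected yet waits until all its parents have selected, and then selects a color from `{1, …, k}`
that is used by the minimum number of parents. -/
def select (k : ℕ) (parents : Finset ℕ) (sel : ℕ) (M : Multiset ℕ) : ℕ :=
  if sel ≠ 0 then sel
  else
    let R := M.filter fun m => m.unpair.1 ∈ parents ∧ m.unpair.2 ≠ 0
    if R.card = parents.card then leastUsed k (R.map fun m => m.unpair.2) else 0

/-- `L` rounds of Procedure Simple-Arbdefective at a vertex with current selection `sel`. -/
def simpleArbdefectiveLoop (k ident : ℕ) (parents : Finset ℕ) : (L : ℕ) → ℕ → Prog ℕ L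
  | 0, sel => sel
  | L + 1, sel => (Nat.pair ident sel, fun M =>
      simpleArbdefectiveLoop k ident parents L (select k parents sel M))

/-- Procedure Simple-Arbdefective for `L` rounds, where `L` bounds the length of the given
orientation. The input of a vertex is its identity and the set of its parents. -/
def simpleArbdefective (k L : ℕ) : Algorithm (ℕ × Finset ℕ) ℕ where
  rounds := L
  prog x := simpleArbdefectiveLoop k x.1 x.2 L (select k x.2 0 0)

/-! ### Procedure Arbdefective-Coloring and Procedure Legal-Coloring -/

/-- Procedure Arbdefective-Coloring with parameters `k` and `t` on a graph of arboricity at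
most `α`. -/
def arbdefectiveColoring (ε : ℝ) (S : Subroutines) (n α k t : ℕ) : Algorithm ℕ ℕ :=
  (partialOrientation ε S n α t).seq (simpleArbdefective k (pathBound ε S n α t))

/-- The new bound on the arboricity of the subgraphs after one phase. -/
def nextArb (ε : ℝ) (p α : ℕ) : ℕ := ⌊(α : ℝ) / p + (2 + ε) * α / p⌋₊

/-- The while-loop of Procedure Legal-Coloring and the final coloring, from the moment when all the
current subgraphs have arboricity at most `α`. The input of a vertex is the index `z` of its
subgraph and its identity. As long as `p < α`, each subgraph is split in parallel by Procedure
Arbdefective-Coloring with `k = t = p`, and its part of color `j` gets the index `(z - 1) p + j`;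
in the end, with `A = ⌊(2 + ε) α⌋ + 1`, the subgraph with index `z` is colored legally from the
palette `{(z - 1) A + 1, …, z A}`. The loop ends also when `α` stops decreasing (instead of running
forever), which never happens when `3 + ε < p`. -/
def legalColoringLoop (ε : ℝ) (S : Subroutines) (n p α : ℕ) : Algorithm (ℕ × ℕ) ℕ :=
  if _h : p < α ∧ nextArb ε p α < α then
    (arbdefectiveColoring ε S n α p p).within.seq
      ((legalColoringLoop ε S n p (nextArb ε p α)).comap
        fun x : (ℕ × ℕ) × ℕ => ((x.1.1 - 1) * p + x.2, x.1.2))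
  else
    (S.legal n α).within.seq
      (Algorithm.ofFun fun x : (ℕ × ℕ) × ℕ => (x.1.1 - 1) * (⌊(2 + ε) * α⌋₊ + 1) + x.2)
termination_by α
decreasing_by exact _h.2

/-- Procedure Legal-Coloring with parameter `p` on an `n`-vertex graph of arboricity `a`. The input
of a vertex is its identity, the output is its color. -/
def legalColoring (ε : ℝ) (S : Subroutines) (n a p : ℕ) : Algorithm ℕ ℕ :=
  (legalColoringLoop ε S n p a).comap fun ident => (1, ident)

end Dist

end

noncomputable section

namespace Dist

/-! ### Semantics of composed algorithms -/

/-! One phase splits a graph of arboricity at most `α` into `p` parts of much smaller arboricity.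
Let `A = ⌊(2 + ε) α⌋`. A vertex has at most `A` neighbours of at least its own `H`-index, hence at
most `A` parents, and by pigeonhole at most `A / p` of them share its least used color. Inside its
`H`-set at most `A / q` edges stay unoriented. Order the vertices by `H`-index, then by defective
color, then by identity: in its own color class each vertex has at most `A / p + A / q ≤ (3 + ε) α /
p` neighbours above it, and such an order splits the class into that many forests
(`arboricity_le_of_key`, `run_arbdefectiveColoring_spec`). Since the orientation follows a rank with
`O(log n) · O(p²)` values, all selections are made within `O(p² log n)` rounds.

A phase thus multiplies the number of subgraphs by `p` and divides the arboricity bound by at least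
`p / (3 + ε)`, so the product of the two grows by at most `3 + ε`. After `i` phases, where `(p / (3
+ ε)) ^ i ≤ a`, the final coloring brings the total to at most `(3 + ε) ^ (i + 1) a` colors
(`legalColoringLoop_spec`). As `i ≤ log a / log (p / (3 + ε))` and `p → ∞`, the factor `(3 + ε) ^ (i
+ 1)` is `a ^ o(1)`. The time bound follows from `p² ≤ f a` and `i ≤ log a`.

Admissible subroutines are built explicitly. Peeling vertices of low degree gives the `H`-partition,
because average degrees are at most `2 α` in all induced subgraphs. Repeated recoloring by quadratic
polynomials over prime fields gives the defective coloring. Block-wise color reduction inside the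
`H`-sets, followed by a greedy pass from the last set to the first, gives the legal coloring. -/

open Classical in
/-- The neighbours of a vertex. -/
def nbrs {V : Type} [Fintype V] (G : SimpleGraph V) (v : V) : Finset V :=
  Finset.univ.filter fun u => G.Adj v u

section Semantics

variable {V : Type} [Fintype V] (G : SimpleGraph V)

@[simp] theorem mem_nbrs {u v : V} : u ∈ nbrs G v ↔ G.Adj v u := by
  simp [nbrs]

/-- The spanning subgraph of the edges whose endpoints have equal labels. -/
def sameLabel {V ι : Type} (G : SimpleGraph V) (z : V → ι) : SimpleGraph V where
  Adj u v := G.Adj u v ∧ z u = z v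
  symm := ⟨fun _ _ h => ⟨h.1.symm, h.2.symm⟩⟩
  loopless := ⟨fun _ h => h.1.ne rfl⟩

@[simp] theorem sameLabel_adj {V ι : Type} {G : SimpleGraph V} {z : V → ι} {u v : V} :
    (sameLabel G z).Adj u v ↔ G.Adj u v ∧ z u = z v := Iff.rfl

theorem exec_succ {O : Type} (T : ℕ) (P : V → Prog O (T + 1)) :
    exec G (T + 1) P =
      exec G T fun v => (P v).2 ((nbrs G v).val.map fun u => (P u).1) := rfl

theorem exec_bind {O O' : Type} {T' : ℕ} (T : ℕ) (P : V → Prog O T)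
    (k : V → O → Prog O' T') :
    exec G (T' + T) (fun v => Prog.bind T (P v) (k v)) =
      exec G T' fun v => k v (exec G T P v) := by
  induction T with
  | zero => rfl
  | succ T ih => exact ih _

/-- The tags let through exactly the messages along edges with equal labels. A parallel run on all
classes is therefore one run on a spanning subgraph, with the same `n` and the same identities, so
the specifications of the subroutines apply to it directly. -/
theorem exec_within {O : Type} (z : V → ℕ) (T : ℕ) (P : V → Prog O T) :
    exec G T (fun v => Prog.within (z v) T (P v)) = exec (sameLabel G z) T P := by
  induction T with
  | zero => rfl
  | succ T ih =>
    rw [exec_succ, exec_succ, ← ih]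
    congr 1
    funext v
    have hM : (((nbrs G v).val.map fun u => Nat.pair (z u) (P u).1).filter
        fun m => m.unpair.1 = z v).map (fun m => m.unpair.2) =
        (nbrs (sameLabel G z) v).val.map fun u => (P u).1 := by
      rw [Multiset.filter_map, Multiset.map_map]
      simp only [Function.comp_def, Nat.unpair_pair]
      congr 1
      rw [← Finset.filter_val]
      congr 1
      ext u
      simp [eq_comm]
    simp only [Prog.within, hM]

namespace Algorithm

variable {I J O σ : Type}

@[simp] theorem run_seq (A : Algorithm I J) (B : Algorithm (I × J) O) (x : V → I) :
    (A.seq B).run G x = B.run G fun v => (x v, A.run G x v) :=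
  exec_bind G A.rounds (fun v => A.prog (x v)) fun v j => B.prog (x v, j)

@[simp] theorem run_within (A : Algorithm I O) (x : V → ℕ × I) :
    A.within.run G x = A.run (sameLabel G fun v => (x v).1) fun v => (x v).2 :=
  exec_within G (fun v => (x v).1) A.rounds fun v => A.prog (x v).2

@[simp] theorem run_comap (A : Algorithm I O) (g : J → I) (x : V → J) :
    (A.comap g).run G x = A.run G fun v => g (x v) := rfl

@[simp] theorem run_ofFun (g : I → O) (x : V → I) :
    (ofFun g).run G x = fun v => g (x v) := rfl

@[simp] theorem rounds_seq (A : Algorithm I J) (B : Algorithm (I × J) O) :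
    (A.seq B).rounds = B.rounds + A.rounds := rfl

@[simp] theorem rounds_within (A : Algorithm I O) : A.within.rounds = A.rounds := rfl

@[simp] theorem rounds_comap (A : Algorithm I O) (g : J → I) :
    (A.comap g).rounds = A.rounds := rfl

@[simp] theorem rounds_ofFun (g : I → O) : (ofFun g).rounds = 0 := rfl

end Algorithm

/-- Repeat for `T` rounds: send a message that depends on the state, and update the state. -/
def Prog.loop {σ : Type} (msg : σ → ℕ) (upd : σ → Multiset ℕ → σ) : (T : ℕ) → σ → Prog σ T
  | 0, s => s
  | T + 1, s => (msg s, fun M => Prog.loop msg upd T (upd s M))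

/-- The algorithm that repeats one round `T` times. -/
def Algorithm.loop {σ : Type} (msg : σ → ℕ) (upd : σ → Multiset ℕ → σ) (T : ℕ) :
    Algorithm σ σ := ⟨T, Prog.loop msg upd T⟩

/-- The effect of one round of a loop on the states of all vertices. -/
def stepAll {σ : Type} (msg : σ → ℕ) (upd : σ → Multiset ℕ → σ) (x : V → σ) : V → σ :=
  fun v => upd (x v) ((nbrs G v).val.map fun u => msg (x u))

@[simp] theorem Algorithm.run_loop {σ : Type} (msg : σ → ℕ) (upd : σ → Multiset ℕ → σ) (T : ℕ)
    (x : V → σ) :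
    (Algorithm.loop msg upd T).run G x = (stepAll G msg upd)^[T] x := by
  induction T generalizing x with
  | zero => rfl
  | succ T ih =>
    rw [Function.iterate_succ_apply, ← ih]
    rfl

@[simp] theorem Algorithm.rounds_loop {σ : Type} (msg : σ → ℕ) (upd : σ → Multiset ℕ → σ)
    (T : ℕ) : (Algorithm.loop msg upd T).rounds = T := rfl

end Semantics

/-! ### Arboricity -/

section Arboricity

variable {V : Type}

/-- On a cycle, the vertex of least key would have two different neighbours above it. -/
theorem isAcyclic_of_subsingleton_higher (F : SimpleGraph V) (key : V → ℕ)
    (hkey : ∀ u v, F.Adj u v → key u ≠ key v)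
    (h : ∀ v u w, F.Adj v u → F.Adj v w → key v < key u → key v < key w → u = w) :
    F.IsAcyclic := by
  classical
  intro v c hc
  obtain ⟨m, hm, hmin⟩ := Finset.exists_min_image c.support.toFinset key
    ⟨v, by simp⟩
  simp only [List.mem_toFinset] at hm hmin
  have hd := hc.rotate hm
  have hmem : ∀ x ∈ (c.rotate m hm).support, x ∈ c.support := fun x hx => by
    simpa using hx
  have hnn : ¬ (c.rotate m hm).Nil := hd.not_nil
  have h1 := SimpleGraph.Walk.adj_snd hnn
  have h2 := (SimpleGraph.Walk.adj_penultimate hnn).symm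
  refine hd.snd_ne_penultimate (h m _ _ h1 h2 ?_ ?_)
  · exact lt_of_le_of_ne (hmin _ (hmem _ (SimpleGraph.Walk.getVert_mem_support _ _)))
      (hkey _ _ h1)
  · exact lt_of_le_of_ne (hmin _ (hmem _ (SimpleGraph.Walk.getVert_mem_support _ _)))
      (hkey _ _ h2)

variable [Fintype V]

/-- Number the higher neighbours of each vertex in the order of their keys, and put the edge to the
`i`-th one into the `i`-th forest. Each vertex then has at most one higher neighbour per forest. -/
theorem exists_forests_of_key (G : SimpleGraph V) (key : V → ℕ) (hkey : Function.Injective key)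
    (d : ℕ) (h : ∀ v, ((nbrs G v).filter fun u => key v < key u).card ≤ d) :
    ∃ F : Fin d → SimpleGraph V, (∀ i, (F i).IsAcyclic) ∧
      (Pairwise fun i j => Disjoint (F i) (F j)) ∧ ⨆ i, F i = G := by
  classical
  let idx : V → V → ℕ := fun v u =>
    ((nbrs G v).filter fun w => key v < key w ∧ key w < key u).card
  have hinj : ∀ v u w, G.Adj v u → G.Adj v w → key v < key u → key v < key w →
      key u < key w → idx v u < idx v w := by
    intro v u w hu hw hvu hvw huw
    refine Finset.card_lt_card ((Finset.ssubset_iff_of_subset ?_).2 ⟨u, ?_, ?_⟩)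
    · intro x
      simp only [Finset.mem_filter, mem_nbrs]
      exact fun hx => ⟨hx.1, hx.2.1, hx.2.2.trans huw⟩
    · simp [hu, hvu, huw]
    · simp
  have hinj' : ∀ v u w, G.Adj v u → G.Adj v w → key v < key u → key v < key w →
      idx v u = idx v w → u = w := by
    intro v u w hu hw hvu hvw he
    rcases lt_trichotomy (key u) (key w) with h1 | h1 | h1
    · exact absurd he (hinj v u w hu hw hvu hvw h1).ne
    · exact hkey h1
    · exact absurd he.symm (hinj v w u hw hu hvw hvu h1).ne
  have hlt : ∀ v u, G.Adj v u → key v < key u → idx v u < d := by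
    intro v u hu hvu
    refine lt_of_lt_of_le (Finset.card_lt_card ((Finset.ssubset_iff_of_subset ?_).2 ⟨u, ?_, ?_⟩))
      (h v)
    · intro x
      simp only [Finset.mem_filter, mem_nbrs]
      exact fun hx => ⟨hx.1, hx.2.1⟩
    · simp [hu, hvu]
    · simp
  let F : Fin d → SimpleGraph V := fun i =>
    { Adj := fun u v => G.Adj u v ∧
        ((key u < key v ∧ idx u v = i) ∨ (key v < key u ∧ idx v u = i))
      symm := ⟨fun u v hh => ⟨hh.1.symm, hh.2.symm⟩⟩
      loopless := ⟨fun u hh => hh.1.ne rfl⟩ }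
  refine ⟨F, fun i => ?_, fun i j hij => ?_, ?_⟩
  · refine isAcyclic_of_subsingleton_higher (F i) key (fun u v huv e => huv.1.ne (hkey e)) ?_
    intro v u w hu hw hvu hvw
    have e1 : idx v u = i := by
      rcases hu.2 with h1 | h1
      · exact h1.2
      · omega
    have e2 : idx v w = i := by
      rcases hw.2 with h1 | h1
      · exact h1.2
      · omega
    exact hinj' v u w hu.1 hw.1 hvu hvw (e1.trans e2.symm)
  · show Disjoint (F i) (F j)
    rw [SimpleGraph.disjoint_left]
    intro u v hi hj
    have hij' : (i : ℕ) ≠ j := fun e => hij (Fin.ext e)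
    rcases hi.2 with h1 | h1 <;> rcases hj.2 with h2 | h2 <;> omega
  · ext u v
    simp only [SimpleGraph.iSup_adj]
    constructor
    · rintro ⟨i, hi⟩
      exact hi.1
    · intro huv
      rcases lt_or_gt_of_ne (fun e => huv.ne (hkey e) : key u ≠ key v) with h1 | h1
      · exact ⟨⟨_, hlt u v huv h1⟩, huv, Or.inl ⟨h1, rfl⟩⟩
      · exact ⟨⟨_, hlt v u huv.symm h1⟩, huv, Or.inr ⟨h1, rfl⟩⟩

/-- If the vertices are ordered such that each has at most `d` neighbours above it, then the
arboricity is at most `d`. -/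
theorem arboricity_le_of_key (G : SimpleGraph V) (key : V → ℕ) (hkey : Function.Injective key)
    (d : ℕ) (h : ∀ v, ((nbrs G v).filter fun u => key v < key u).card ≤ d) :
    arboricity G ≤ d :=
  Nat.sInf_le (exists_forests_of_key G key hkey d h)

/-- The infimum is attained because the set is nonempty: any enumeration of the vertices as key
yields a cover by `Fintype.card V` forests. -/
theorem exists_forests (G : SimpleGraph V) :
    ∃ F : Fin (arboricity G) → SimpleGraph V, (∀ i, (F i).IsAcyclic) ∧
      (Pairwise fun i j => Disjoint (F i) (F j)) ∧ ⨆ i, F i = G := by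
  refine Nat.sInf_mem (s := {k | ∃ F : Fin k → SimpleGraph V, (∀ i, (F i).IsAcyclic) ∧
    (Pairwise fun i j => Disjoint (F i) (F j)) ∧ ⨆ i, F i = G}) ⟨Fintype.card V, ?_⟩
  exact exists_forests_of_key G (fun v => Fintype.equivFin V v)
    (Fin.val_injective.comp (Fintype.equivFin V).injective) _ fun v => Finset.card_le_univ _

-- The forest induced on `W` extends to a spanning tree of the complete graph on `W`, so it has
-- fewer than `W.card` edges; the degree sum is twice their number.
open Classical in
theorem sum_card_nbrs_le_of_isAcyclic (F : SimpleGraph V) (hF : F.IsAcyclic) (W : Finset V) :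
    ∑ v ∈ W, ((nbrs F v).filter fun u => u ∈ W).card ≤ 2 * W.card := by
  rcases W.eq_empty_or_nonempty with rfl | hW
  · simp
  have : Nonempty W := hW.to_subtype
  let H : SimpleGraph W := F.comap (Function.Embedding.subtype _)
  have hH : H.IsAcyclic := hF.of_comap (Function.Embedding.subtype _)
  obtain ⟨T, hHT, -, hT⟩ :=
    (SimpleGraph.connected_top (V := W)).exists_isTree_le_of_le_of_isAcyclic le_top hH
  have h1 : H.edgeFinset.card ≤ T.edgeFinset.card :=
    Finset.card_le_card (SimpleGraph.edgeFinset_mono hHT)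
  have h2 := hT.card_edgeFinset
  have h3 := H.sum_degrees_eq_twice_card_edges
  have h4 : ∑ v ∈ W, ((nbrs F v).filter fun u => u ∈ W).card = ∑ v : W, H.degree v := by
    rw [← Finset.sum_coe_sort W]
    refine Finset.sum_congr rfl fun v _ => ?_
    rw [← SimpleGraph.card_neighborFinset_eq_degree,
      ← Finset.card_map (Function.Embedding.subtype (· ∈ W))]
    congr 1
    ext u
    simp only [Finset.mem_filter, mem_nbrs, Finset.mem_map, SimpleGraph.mem_neighborFinset]
    exact ⟨fun h => ⟨⟨u, h.2⟩, h.1, rfl⟩, by rintro ⟨x, hx, rfl⟩; exact ⟨hx, x.2⟩⟩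
  rw [Fintype.card_coe] at h2
  omega

open Classical in
/-- The sum of the degrees in an induced subgraph is at most `2 α` times the number of its
vertices. -/
theorem sum_card_nbrs_le (G : SimpleGraph V) {α : ℕ} (hα : arboricity G ≤ α) (W : Finset V) :
    ∑ v ∈ W, ((nbrs G v).filter fun u => u ∈ W).card ≤ 2 * α * W.card := by
  obtain ⟨F, hF, -, hsup⟩ := exists_forests G
  calc ∑ v ∈ W, ((nbrs G v).filter fun u => u ∈ W).card
      ≤ ∑ v ∈ W, ∑ i, ((nbrs (F i) v).filter fun u => u ∈ W).card := by
        refine Finset.sum_le_sum fun v _ => le_trans (Finset.card_le_card ?_) Finset.card_biUnion_le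
        intro u hu
        simp only [Finset.mem_filter, mem_nbrs] at hu
        have hadj : (⨆ i, F i).Adj v u := by rw [hsup]; exact hu.1
        obtain ⟨i, hi⟩ := SimpleGraph.iSup_adj.1 hadj
        exact Finset.mem_biUnion.2 ⟨i, Finset.mem_univ i, by simp [hi, hu.2]⟩
    _ = ∑ i, ∑ v ∈ W, ((nbrs (F i) v).filter fun u => u ∈ W).card := Finset.sum_comm
    _ ≤ ∑ _i : Fin (arboricity G), 2 * W.card :=
        Finset.sum_le_sum fun i _ => sum_card_nbrs_le_of_isAcyclic (F i) (hF i) W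
    _ = arboricity G * (2 * W.card) := by simp
    _ ≤ 2 * α * W.card := by
        calc arboricity G * (2 * W.card) ≤ α * (2 * W.card) := Nat.mul_le_mul_right _ hα
          _ = _ := by ring

theorem arboricity_eq_zero_of_card_le_one (G : SimpleGraph V) (h : Fintype.card V ≤ 1) :
    arboricity G = 0 := by
  have := Fintype.card_le_one_iff_subsingleton.1 h
  refine Nat.le_zero.1 (arboricity_le_of_key G (fun _ => 0) (fun _ _ _ => Subsingleton.elim _ _) 0
    fun v => ?_)
  simp

end Arboricity

/-! ### Computing an `H`-partition -/

theorem count_map_val {V : Type} (s : Finset V) (g : V → ℕ) (b : ℕ) :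
    (s.val.map g).count b = (s.filter fun u => g u = b).card := by
  rw [Multiset.count_map, Finset.card_def, Finset.filter_val]
  simp only [eq_comm]

/-- For `T` rounds, all the active vertices with at most `A` active neighbours take the number of
the current round as their `H`-index and become inactive. The `H`-index of an active vertex
is `0`. -/
def peel (A T : ℕ) : Algorithm ℕ ℕ :=
  ((Algorithm.loop (fun s : ℕ × ℕ => s.2)
    (fun s M => (s.1 + 1, if s.2 = 0 ∧ M.count 0 ≤ A then s.1 + 1 else s.2)) T).seq
      (Algorithm.ofFun fun x => x.2.2)).comap fun _ => (0, 0)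

section Peel

variable {V : Type} [Fintype V] (G : SimpleGraph V) (A : ℕ)

/-- The `H`-indices after `r` rounds of peeling. -/
def peelIndex : ℕ → V → ℕ
  | 0, _ => 0
  | r + 1, v =>
      if peelIndex r v = 0 ∧ ((nbrs G v).filter fun u => peelIndex r u = 0).card ≤ A then r + 1
      else peelIndex r v

theorem run_peel (T : ℕ) (x : V → ℕ) : (peel A T).run G x = peelIndex G A T := by
  have key : ∀ r, (stepAll G (fun s : ℕ × ℕ => s.2)
      (fun s M => (s.1 + 1, if s.2 = 0 ∧ M.count 0 ≤ A then s.1 + 1 else s.2)))^[r]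
      (fun _ => (0, 0)) = fun v => (r, peelIndex G A r v) := by
    intro r
    induction r with
    | zero => rfl
    | succ r ih =>
      rw [Function.iterate_succ_apply', ih]
      funext v
      simp only [stepAll, peelIndex, count_map_val]
  simp [peel, key]

variable {G A}

theorem peelIndex_of_ne_zero {r : ℕ} {v : V} (h : peelIndex G A r v ≠ 0) {s : ℕ} (hs : r ≤ s) :
    peelIndex G A s v = peelIndex G A r v := by
  induction s, hs using Nat.le_induction with
  | base => rfl
  | succ s _ ih =>
    rw [peelIndex, if_neg (fun h' => h (ih ▸ h'.1)), ih]

theorem exists_of_peelIndex_ne_zero {r : ℕ} {v : V} (h : peelIndex G A r v ≠ 0) :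
    ∃ s < r, peelIndex G A r v = s + 1 ∧
      ((nbrs G v).filter fun u => peelIndex G A s u = 0).card ≤ A := by
  induction r with
  | zero => exact absurd rfl h
  | succ r ih =>
    by_cases hc : peelIndex G A r v = 0 ∧
        ((nbrs G v).filter fun u => peelIndex G A r u = 0).card ≤ A
    · exact ⟨r, by omega, by rw [peelIndex, if_pos hc], hc.2⟩
    · rw [peelIndex, if_neg hc] at h ⊢
      obtain ⟨s, hs, h1⟩ := ih h
      exact ⟨s, by omega, h1⟩

/-- A vertex of index `s + 1` had at most `A` active neighbours after `s` rounds, and every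
neighbour of at least this index was among them. -/
theorem card_higher_le_of_peelIndex_ne_zero {T : ℕ} {v : V} (h : peelIndex G A T v ≠ 0) :
    ((nbrs G v).filter fun u => peelIndex G A T v ≤ peelIndex G A T u).card ≤ A := by
  obtain ⟨s, hs, h1, h2⟩ := exists_of_peelIndex_ne_zero h
  refine le_trans (Finset.card_le_card fun u => ?_) h2
  simp only [Finset.mem_filter, h1]
  refine fun hu => ⟨hu.1, ?_⟩
  by_contra h0
  obtain ⟨s', hs', h3, -⟩ := exists_of_peelIndex_ne_zero h0
  have := peelIndex_of_ne_zero h0 hs.le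
  omega

open Classical in
/-- The active vertices after `r` rounds of peeling. -/
def peelActive (G : SimpleGraph V) (A r : ℕ) : Finset V :=
  Finset.univ.filter fun v => peelIndex G A r v = 0

/-- Double counting: every surviving vertex had at least `A + 1` active neighbours, while the degree
sum in the active subgraph is at most `2 α` times its order. -/
theorem card_peelActive_succ_le {α : ℕ} (hα : arboricity G ≤ α) (r : ℕ) :
    (A + 1) * (peelActive G A (r + 1)).card ≤ 2 * α * (peelActive G A r).card := by
  classical
  have hsub : peelActive G A (r + 1) ⊆ peelActive G A r := by
    intro v
    simp only [peelActive, Finset.mem_filter, Finset.mem_univ, true_and]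
    intro hv
    by_contra h0
    exact h0 ((peelIndex_of_ne_zero h0 (Nat.le_succ r)) ▸ hv)
  calc (A + 1) * (peelActive G A (r + 1)).card
      = ∑ _v ∈ peelActive G A (r + 1), (A + 1) := by
        rw [Finset.sum_const, smul_eq_mul, mul_comm]
    _ ≤ ∑ v ∈ peelActive G A (r + 1), ((nbrs G v).filter fun u => u ∈ peelActive G A r).card := by
        refine Finset.sum_le_sum fun v hv => ?_
        have hv0 := hsub hv
        simp only [peelActive, Finset.mem_filter, Finset.mem_univ, true_and] at hv hv0 ⊢
        rw [peelIndex] at hv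
        by_contra hlt
        rw [if_pos ⟨hv0, by omega⟩] at hv
        omega
    _ ≤ ∑ v ∈ peelActive G A r, ((nbrs G v).filter fun u => u ∈ peelActive G A r).card :=
        Finset.sum_le_sum_of_subset hsub
    _ ≤ 2 * α * (peelActive G A r).card := by
        convert sum_card_nbrs_le G hα _

/-- As `A + 1 ≥ (2 + ε) α`, each round shrinks the active set by the factor `1 + ε / 2`, so after
`T` rounds fewer than one vertex is left. -/
theorem peelIndex_ne_zero {ε : ℝ} (hε : 0 < ε) {α : ℕ} (h1 : 1 ≤ α) (hα : arboricity G ≤ α)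
    {T : ℕ} (hT : (Fintype.card V : ℝ) < (1 + ε / 2) ^ T) (v : V) :
    peelIndex G ⌊(2 + ε) * α⌋₊ T v ≠ 0 := by
  set A := ⌊(2 + ε) * α⌋₊ with hA
  have hα0 : (0 : ℝ) < α := by exact_mod_cast h1
  have hA' : (2 + ε) * α ≤ (A : ℝ) + 1 := (Nat.lt_floor_add_one _).le
  have hshrink : ∀ r, (1 + ε / 2) ^ r * ((peelActive G A r).card : ℝ) ≤ Fintype.card V := by
    intro r
    induction r with
    | zero => simpa using Finset.card_le_univ (peelActive G A 0)
    | succ r ih =>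
      have h2 : ((A : ℝ) + 1) * (peelActive G A (r + 1)).card ≤
          2 * α * (peelActive G A r).card := by
        exact_mod_cast card_peelActive_succ_le (A := A) hα r
      have h3 : (1 + ε / 2) * ((peelActive G A (r + 1)).card : ℝ) ≤ (peelActive G A r).card := by
        have h4 : (2 * (α : ℝ)) * ((1 + ε / 2) * ((peelActive G A (r + 1)).card : ℝ)) ≤
            (2 * α) * (peelActive G A r).card := by
          refine le_trans ?_ h2
          rw [← mul_assoc]
          exact mul_le_mul_of_nonneg_right (by linarith) (Nat.cast_nonneg _)
        exact le_of_mul_le_mul_left h4 (by positivity)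
      calc (1 + ε / 2) ^ (r + 1) * ((peelActive G A (r + 1)).card : ℝ)
          = (1 + ε / 2) ^ r * ((1 + ε / 2) * ((peelActive G A (r + 1)).card : ℝ)) := by ring
        _ ≤ (1 + ε / 2) ^ r * ((peelActive G A r).card : ℝ) := by gcongr
        _ ≤ _ := ih
  intro h0
  have hpos : 1 ≤ (peelActive G A T).card :=
    Finset.card_pos.2 ⟨v, by simp [peelActive, h0]⟩
  have hpos' : (1 : ℝ) ≤ (peelActive G A T).card := by exact_mod_cast hpos
  have := hshrink T
  have : (1 + ε / 2) ^ T * 1 ≤ (1 + ε / 2) ^ T * ((peelActive G A T).card : ℝ) := by gcongr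
  linarith

end Peel

/-- The number of rounds after which peeling is complete. -/
def peelRounds (ε : ℝ) (n : ℕ) : ℕ := ⌊Real.logb (1 + ε / 2) n⌋₊ + 1

theorem lt_pow_peelRounds {ε : ℝ} (hε : 0 < ε) {n : ℕ} (hn : 1 ≤ n) :
    (n : ℝ) < (1 + ε / 2) ^ peelRounds ε n := by
  have h := Nat.lt_floor_add_one (Real.logb (1 + ε / 2) n)
  rw [Real.logb_lt_iff_lt_rpow (by linarith) (by exact_mod_cast hn)] at h
  rw [← Real.rpow_natCast, peelRounds]
  push_cast
  exact h

theorem one_le_logb {n : ℕ} (hn : 2 ≤ n) : 1 ≤ Real.logb 2 n := by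
  rw [Real.le_logb_iff_rpow_le (by norm_num) (by positivity)]
  simpa using hn

theorem peelRounds_le {ε : ℝ} (hε : 0 < ε) {n : ℕ} (hn : 2 ≤ n) :
    (peelRounds ε n : ℝ) ≤ ((Real.logb 2 (1 + ε / 2))⁻¹ + 1) * Real.logb 2 n := by
  have h1 := one_le_logb hn
  have h2 : 0 ≤ Real.logb (1 + ε / 2) n :=
    Real.logb_nonneg (by linarith) (by exact_mod_cast (by omega : 1 ≤ n))
  have h3 := Nat.floor_le h2
  have h4 : Real.logb (1 + ε / 2) n = (Real.logb 2 (1 + ε / 2))⁻¹ * Real.logb 2 n := by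
    simp only [Real.logb]
    have : Real.log (1 + ε / 2) ≠ 0 := (Real.log_pos (by linarith)).ne'
    have : Real.log 2 ≠ 0 := (Real.log_pos (by norm_num)).ne'
    field_simp
  rw [peelRounds]
  push_cast
  rw [add_mul, ← h4]
  linarith

/-! ### Computing a defective coloring -/

theorem card_filter_map_val {V : Type} (s : Finset V) (g : V → ℕ) (q : ℕ → Prop)
    [DecidablePred q] :
    ((s.val.map g).filter q).card = (s.filter fun u => q (g u)).card := by
  rw [Multiset.filter_map, Multiset.card_map, ← Finset.filter_val]
  rfl

/-- The value at `x` of the quadratic polynomial modulo `P` whose coefficients are the digits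
of `c` in base `P`. -/
def evalQuad (P c x : ℕ) : ℕ := (c % P + c / P % P * x + c / P ^ 2 * x ^ 2) % P

/-- Numbers below `P ^ 3` are determined by three digits in base `P`, so the difference of the two
polynomials is nonzero of degree at most 2 over the field `ZMod P` and has at most two roots. -/
theorem card_evalQuad_eq_le {P : ℕ} (hP : P.Prime) {a b : ℕ} (ha : a < P ^ 3) (hb : b < P ^ 3)
    (hab : a ≠ b) :
    ((Finset.range P).filter fun x => evalQuad P a x = evalQuad P b x).card ≤ 2 := by
  classical
  have : Fact P.Prime := ⟨hP⟩
  have hcast : ∀ {x y : ℕ}, x < P → y < P → (x : ZMod P) = y → x = y := by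
    intro x y hx hy h
    rw [ZMod.natCast_eq_natCast_iff] at h
    exact Nat.ModEq.eq_of_lt_of_lt h hx hy
  let q : Polynomial (ZMod P) :=
    Polynomial.C (((a / P ^ 2 : ℕ) : ZMod P) - ((b / P ^ 2 : ℕ) : ZMod P)) * Polynomial.X ^ 2 +
    Polynomial.C (((a / P % P : ℕ) : ZMod P) - ((b / P % P : ℕ) : ZMod P)) * Polynomial.X +
    Polynomial.C (((a % P : ℕ) : ZMod P) - ((b % P : ℕ) : ZMod P))
  have hq : q ≠ 0 := by
    intro hq
    have h0 : q.coeff 0 = 0 := by rw [hq]; simp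
    have h1 : q.coeff 1 = 0 := by rw [hq]; simp
    have h2 : q.coeff 2 = 0 := by rw [hq]; simp
    simp only [q, Polynomial.coeff_add, Polynomial.coeff_C_mul, Polynomial.coeff_X_pow,
      Polynomial.coeff_X, Polynomial.coeff_C] at h0 h1 h2
    simp [sub_eq_zero] at h0 h1 h2
    have hdiv : ∀ {c : ℕ}, c < P ^ 3 → c / P ^ 2 < P := fun hc => by
      rw [Nat.div_lt_iff_lt_mul (pow_pos hP.pos 2)]
      calc _ < P ^ 3 := hc
        _ = P * P ^ 2 := by ring
    have e0 : a % P = b % P := hcast (Nat.mod_lt _ hP.pos) (Nat.mod_lt _ hP.pos) (by simpa using h0)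
    have e1 : a / P % P = b / P % P :=
      hcast (Nat.mod_lt _ hP.pos) (Nat.mod_lt _ hP.pos) (by simpa using h1)
    have e2 : a / P ^ 2 = b / P ^ 2 := hcast (hdiv ha) (hdiv hb) (by simpa using h2)
    have e3 : a / P = b / P := by
      rw [← Nat.mod_add_div (a / P) P, ← Nat.mod_add_div (b / P) P, Nat.div_div_eq_div_mul,
        Nat.div_div_eq_div_mul, ← sq, e1, e2]
    exact hab (by rw [← Nat.mod_add_div a P, ← Nat.mod_add_div b P, e0, e3])
  have hdeg : q.natDegree ≤ 2 := Polynomial.natDegree_quadratic_le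
  calc ((Finset.range P).filter fun x => evalQuad P a x = evalQuad P b x).card
      ≤ q.roots.toFinset.card := by
        refine Finset.card_le_card_of_injOn (fun x => (x : ZMod P)) ?_ ?_
        · intro x hx
          simp only [Finset.coe_filter, Finset.mem_range, Set.mem_ofPred_eq] at hx
          have h := (ZMod.natCast_eq_natCast_iff _ _ P).2
            (show _ ≡ _ [MOD P] from hx.2)
          push_cast at h
          rw [Finset.mem_coe, Multiset.mem_toFinset, Polynomial.mem_roots hq, Polynomial.IsRoot]
          simp only [q, Polynomial.eval_add, Polynomial.eval_mul, Polynomial.eval_C,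
            Polynomial.eval_pow, Polynomial.eval_X]
          linear_combination h
        · intro x hx y hy h
          simp only [Finset.coe_filter, Finset.mem_range, Set.mem_ofPred_eq] at hx hy
          exact hcast hx.1 hy.1 h
    _ ≤ Multiset.card q.roots := Multiset.toFinset_card_le _
    _ ≤ q.natDegree := Polynomial.card_roots' q
    _ ≤ 2 := hdeg

/-- The number of entries of `M` which differ from `c` but agree with `c` at `x` as quadratic
polynomials. -/
def collisions (P c : ℕ) (M : Multiset ℕ) (x : ℕ) : ℕ :=
  (M.filter fun c' => c' ≠ c ∧ evalQuad P c' x = evalQuad P c x).card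

/-- The point at which a vertex of color `c` evaluates its polynomial. -/
def evalPoint (P c : ℕ) (M : Multiset ℕ) : ℕ :=
  Classical.epsilon fun x => x < P ∧ P * collisions P c M x ≤ 2 * M.card

/-- One round of color reduction. -/
def recolor (P c : ℕ) (M : Multiset ℕ) : ℕ :=
  evalPoint P c M * P + evalQuad P c (evalPoint P c M)

section Recolor

variable {V : Type} [Fintype V] (G : SimpleGraph V)

/-- Averaging: each neighbour of another color collides with `v` in at most two of the `P` points,
so some point has at most `2 / P` collisions per neighbour. -/
theorem evalPoint_spec {P : ℕ} (hP : P.Prime) {col : V → ℕ} (hcol : ∀ v, col v < P ^ 3) (v : V) :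
    evalPoint P (col v) ((nbrs G v).val.map col) < P ∧
      P * collisions P (col v) ((nbrs G v).val.map col)
        (evalPoint P (col v) ((nbrs G v).val.map col)) ≤ 2 * (nbrs G v).card := by
  set M := (nbrs G v).val.map col with hM
  have hcard : M.card = (nbrs G v).card := by simp [hM]
  have hsum : ∑ x ∈ Finset.range P, collisions P (col v) M x ≤ 2 * M.card := by
    calc ∑ x ∈ Finset.range P, collisions P (col v) M x
        = ∑ x ∈ Finset.range P, ∑ u ∈ nbrs G v,
            if col u ≠ col v ∧ evalQuad P (col u) x = evalQuad P (col v) x then 1 else 0 := by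
          refine Finset.sum_congr rfl fun x _ => ?_
          rw [collisions, hM, card_filter_map_val, Finset.card_filter]
      _ = ∑ u ∈ nbrs G v, ((Finset.range P).filter fun x =>
            col u ≠ col v ∧ evalQuad P (col u) x = evalQuad P (col v) x).card := by
          rw [Finset.sum_comm]
          simp only [Finset.card_filter]
      _ ≤ ∑ _u ∈ nbrs G v, 2 := by
          refine Finset.sum_le_sum fun u _ => ?_
          by_cases h : col u = col v
          · simp [h]
          · simpa [h] using card_evalQuad_eq_le hP (hcol u) (hcol v) h
      _ = 2 * M.card := by simp [hcard, mul_comm]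
  have hex : ∃ x, x < P ∧ P * collisions P (col v) M x ≤ 2 * M.card := by
    obtain ⟨x, hx, h⟩ := Finset.exists_le_of_sum_le (s := Finset.range P)
      (f := fun x => P * collisions P (col v) M x) (g := fun _ => 2 * M.card)
      ⟨0, by simpa using hP.pos⟩ (by
        rw [← Finset.mul_sum]
        simpa using Nat.mul_le_mul_left P hsum)
    exact ⟨x, by simpa using hx, h⟩
  rw [← hcard]
  exact Classical.epsilon_spec hex

theorem recolor_lt {P : ℕ} (hP : P.Prime) {col : V → ℕ} (hcol : ∀ v, col v < P ^ 3) (v : V) :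
    recolor P (col v) ((nbrs G v).val.map col) < P ^ 2 := by
  have h1 := (evalPoint_spec G hP hcol v).1
  have h2 : evalQuad P (col v) (evalPoint P (col v) ((nbrs G v).val.map col)) < P :=
    Nat.mod_lt _ hP.pos
  rw [recolor]
  nlinarith

-- The new color encodes the pair (point, value). A neighbour with the same new color either had the
-- same old color or collides with `v` at the point chosen by `v`; the choice of the point limits
-- the latter to `2 Δ / P`.
open Classical in
theorem card_recolor_eq_le {P : ℕ} (hP : P.Prime) {col : V → ℕ} (hcol : ∀ v, col v < P ^ 3)
    {Δ : ℕ} (hΔ : ∀ v, (nbrs G v).card ≤ Δ) (v : V) :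
    (((nbrs G v).filter fun u => recolor P (col u) ((nbrs G u).val.map col) =
      recolor P (col v) ((nbrs G v).val.map col)).card : ℝ) ≤
      ((nbrs G v).filter fun u => col u = col v).card + 2 * Δ / P := by
  have h1 := (evalPoint_spec G hP hcol v).2
  set x := evalPoint P (col v) ((nbrs G v).val.map col) with hx
  rw [collisions, card_filter_map_val] at h1
  have hsub : ((nbrs G v).filter fun u => recolor P (col u) ((nbrs G u).val.map col) =
      recolor P (col v) ((nbrs G v).val.map col)) ⊆
      ((nbrs G v).filter fun u => col u = col v) ∪
      ((nbrs G v).filter fun u => col u ≠ col v ∧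
        evalQuad P (col u) x = evalQuad P (col v) x) := by
    intro u hu
    simp only [Finset.mem_filter] at hu
    simp only [Finset.mem_union, Finset.mem_filter]
    by_cases hc : col u = col v
    · exact Or.inl ⟨hu.1, hc⟩
    · refine Or.inr ⟨hu.1, hc, ?_⟩
      have he := hu.2
      have m1 : evalQuad P (col u) (evalPoint P (col u) ((nbrs G u).val.map col)) < P :=
        Nat.mod_lt _ hP.pos
      have m2 : evalQuad P (col v) x < P := Nat.mod_lt _ hP.pos
      rw [recolor, recolor, ← hx] at he
      -- The residue modulo `P` recovers the value; cancelling it recovers the point.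
      have d2 := congrArg (· % P) he
      simp only [Nat.mul_add_mod', Nat.mod_eq_of_lt m1,
        Nat.mod_eq_of_lt m2] at d2
      have d3 : evalPoint P (col u) ((nbrs G u).val.map col) = x := by
        rw [d2] at he
        exact Nat.eq_of_mul_eq_mul_right hP.pos (Nat.add_right_cancel he)
      rw [← d2, d3]
  have h2 := (Finset.card_le_card hsub).trans (Finset.card_union_le _ _)
  have hP0 : (0 : ℝ) < P := by exact_mod_cast hP.pos
  have h3 : (((nbrs G v).filter fun u => col u ≠ col v ∧
        evalQuad P (col u) x = evalQuad P (col v) x).card : ℝ) ≤ 2 * Δ / P := by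
    rw [le_div_iff₀ hP0, mul_comm]
    exact_mod_cast h1.trans (Nat.mul_le_mul_left 2 (hΔ v))
  refine le_trans (Nat.cast_le.2 h2) ?_
  push_cast
  linarith

end Recolor

/-- A sequence of primes, each of which exceeds twice its predecessor. -/
def primeSeq (q : ℕ) : ℕ → ℕ
  | 0 => Classical.epsilon fun P => P.Prime ∧ 16 * q < P ∧ P ≤ 32 * q
  | i + 1 => Classical.epsilon fun P => P.Prime ∧ 2 * primeSeq q i < P ∧ P ≤ 4 * primeSeq q i

/-- Bertrand's postulate supplies the primes. The factor 16 gives `(4 P) ^ 2 ≤ P ^ 3`, so that the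
colors produced with one prime are admissible for the preceding smaller one; it also more than
ensures `4 Δ / P ≤ Δ / q`. -/
theorem primeSeq_zero_spec {q : ℕ} (hq : 1 ≤ q) :
    (primeSeq q 0).Prime ∧ 16 * q < primeSeq q 0 ∧ primeSeq q 0 ≤ 32 * q := by
  refine Classical.epsilon_spec (p := fun P => P.Prime ∧ 16 * q < P ∧ P ≤ 32 * q) ?_
  obtain ⟨P, h⟩ := Nat.exists_prime_lt_and_le_two_mul (16 * q) (by omega)
  exact ⟨P, h.1, h.2.1, by omega⟩

theorem primeSeq_succ_spec {q i : ℕ} (h : 1 ≤ primeSeq q i) :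
    (primeSeq q (i + 1)).Prime ∧ 2 * primeSeq q i < primeSeq q (i + 1) ∧
      primeSeq q (i + 1) ≤ 4 * primeSeq q i := by
  refine Classical.epsilon_spec
    (p := fun P => P.Prime ∧ 2 * primeSeq q i < P ∧ P ≤ 4 * primeSeq q i) ?_
  obtain ⟨P, h⟩ := Nat.exists_prime_lt_and_le_two_mul (2 * primeSeq q i) (by omega)
  exact ⟨P, h.1, h.2.1, by omega⟩

theorem primeSeq_prime {q : ℕ} (hq : 1 ≤ q) (i : ℕ) : (primeSeq q i).Prime := by
  induction i with
  | zero => exact (primeSeq_zero_spec hq).1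
  | succ i ih => exact (primeSeq_succ_spec ih.one_le).1

theorem le_primeSeq {q : ℕ} (hq : 1 ≤ q) (i : ℕ) : 16 * q * 2 ^ i ≤ primeSeq q i := by
  induction i with
  | zero => simpa using (primeSeq_zero_spec hq).2.1.le
  | succ i ih =>
    have := (primeSeq_succ_spec (primeSeq_prime hq i).one_le).2.1
    rw [pow_succ, ← mul_assoc]
    omega

/-- Repeated color reduction for `T` rounds; the state consists of the number of the remaining
rounds and the color. -/
def reduceLoop (q T : ℕ) : Algorithm (ℕ × ℕ) (ℕ × ℕ) :=
  Algorithm.loop (fun s => s.2)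
    (fun s M => (s.1 - 1, recolor (primeSeq q (s.1 - 1)) s.2 M)) T

theorem run_reduceLoop_succ {V : Type} [Fintype V] (G : SimpleGraph V) (q T : ℕ) (col : V → ℕ) :
    (reduceLoop q (T + 1)).run G (fun v => (T + 1, col v)) =
      (reduceLoop q T).run G fun v =>
        (T, recolor (primeSeq q T) (col v) ((nbrs G v).val.map col)) := by
  simp only [reduceLoop, Algorithm.run_loop, Function.iterate_succ_apply]
  rfl

-- The primes are used from the largest down to the smallest, and the round with prime `P` costs `2
-- Δ / P` in defect. As the primes at least double, these costs form a geometric sum. The subtracted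
-- term makes the induction close: it leaves room for the cost of the next larger prime.
open Classical in
theorem run_reduceLoop_spec {V : Type} [Fintype V] (G : SimpleGraph V) {q : ℕ} (hq : 1 ≤ q)
    {Δ : ℕ} (hΔ : ∀ v, (nbrs G v).card ≤ Δ) (T : ℕ) (col : V → ℕ)
    (hcol : ∀ v, col v < primeSeq q T ^ 3) (v : V) :
    ((reduceLoop q (T + 1)).run G (fun v => (T + 1, col v)) v).2 < primeSeq q 0 ^ 2 ∧
    (((nbrs G v).filter fun u =>
      ((reduceLoop q (T + 1)).run G (fun v => (T + 1, col v)) u).2 =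
        ((reduceLoop q (T + 1)).run G (fun v => (T + 1, col v)) v).2).card : ℝ) ≤
      ((nbrs G v).filter fun u => col u = col v).card +
        (4 * Δ / primeSeq q 0 - 2 * Δ / primeSeq q T) := by
  induction T generalizing col v with
  | zero =>
    rw [run_reduceLoop_succ]
    have hP := primeSeq_prime hq 0
    refine ⟨recolor_lt G hP hcol v, (card_recolor_eq_le G hP hcol hΔ v).trans (le_of_eq ?_)⟩
    ring
  | succ T ih =>
    rw [run_reduceLoop_succ]
    have hP := primeSeq_prime hq (T + 1)
    have hP' := primeSeq_prime hq T
    have hs := primeSeq_succ_spec hP'.one_le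
    have hcol' : ∀ v, recolor (primeSeq q (T + 1)) (col v) ((nbrs G v).val.map col) <
        primeSeq q T ^ 3 := by
      intro v
      have h1 := recolor_lt G hP hcol v
      have h2 : 16 ≤ primeSeq q T := by
        have := le_primeSeq hq T
        have : 1 ≤ 2 ^ T := Nat.one_le_two_pow
        nlinarith
      calc _ < primeSeq q (T + 1) ^ 2 := h1
        _ ≤ (4 * primeSeq q T) ^ 2 := Nat.pow_le_pow_left hs.2.2 2
        _ = 16 * primeSeq q T ^ 2 := by ring
        _ ≤ primeSeq q T * primeSeq q T ^ 2 := Nat.mul_le_mul_right _ h2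
        _ = _ := by ring
    obtain ⟨h1, h2⟩ := ih _ hcol' v
    refine ⟨h1, h2.trans ?_⟩
    have h3 := card_recolor_eq_le G hP hcol hΔ v
    have h4 : 2 * (Δ : ℝ) / primeSeq q (T + 1) + 2 * Δ / primeSeq q (T + 1) ≤
        2 * Δ / primeSeq q T := by
      have p1 : (0 : ℝ) < primeSeq q T := by exact_mod_cast hP'.pos
      have p2 : (2 : ℝ) * primeSeq q T ≤ primeSeq q (T + 1) := by exact_mod_cast hs.2.1.le
      have p3 : (0 : ℝ) < primeSeq q (T + 1) := by exact_mod_cast hP.pos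
      rw [← add_div, div_le_div_iff₀ p3 p1]
      have : (0 : ℝ) ≤ Δ := Nat.cast_nonneg _
      nlinarith
    linarith

/-- An algorithm for defective coloring. -/
def defectiveAlg (n q : ℕ) : Algorithm ℕ ℕ :=
  ((reduceLoop q (Nat.clog 2 n + 1)).seq (Algorithm.ofFun fun x => x.2.2 + 1)).comap
    fun i => (Nat.clog 2 n + 1, i - 1)

-- The identities are an initial coloring without defect. They lie below the largest prime, which
-- exceeds `2 ^ Nat.clog 2 n ≥ n`, so logarithmically many rounds bring the number of colors down to
-- the square of the first prime.
open Classical in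
theorem run_defectiveAlg_spec {V : Type} [Fintype V] (G : SimpleGraph V) {ident : V → ℕ}
    (hid : IsIdentity ident) {Δ q : ℕ} (hq : 1 ≤ q) (hΔ : ∀ v, (nbrs G v).card ≤ Δ) (v : V) :
    1 ≤ (defectiveAlg (Fintype.card V) q).run G ident v ∧
      (defectiveAlg (Fintype.card V) q).run G ident v ≤ primeSeq q 0 ^ 2 ∧
      ((nbrs G v).filter fun u => (defectiveAlg (Fintype.card V) q).run G ident u =
          (defectiveAlg (Fintype.card V) q).run G ident v).card ≤ Δ / q := by
  set n := Fintype.card V with hn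
  have hcol : ∀ v, ident v - 1 < primeSeq q (Nat.clog 2 n) ^ 3 := by
    intro v
    have h1 := hid.2 v
    have h2 : n ≤ 2 ^ Nat.clog 2 n := Nat.le_pow_clog (by norm_num) _
    have h3 := le_primeSeq hq (Nat.clog 2 n)
    have h4 : primeSeq q (Nat.clog 2 n) ≤ primeSeq q (Nat.clog 2 n) ^ 3 :=
      Nat.le_self_pow (by norm_num) _
    have h5 : 2 ^ Nat.clog 2 n ≤ 16 * q * 2 ^ Nat.clog 2 n :=
      Nat.le_mul_of_pos_left _ (by omega)
    omega
  obtain ⟨h1, h2⟩ := run_reduceLoop_spec G hq hΔ _ _ hcol v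
  have hrun : ∀ v, (defectiveAlg n q).run G ident v =
      ((reduceLoop q (Nat.clog 2 n + 1)).run G
        (fun v => (Nat.clog 2 n + 1, ident v - 1)) v).2 + 1 := fun v => by
    simp [defectiveAlg]
  simp only [hrun, Nat.add_right_cancel_iff]
  refine ⟨by omega, by omega, ?_⟩
  have h0 : ((nbrs G v).filter fun u => ident u - 1 = ident v - 1) = ∅ := by
    refine Finset.filter_eq_empty_iff.2 fun u hu he => ?_
    have e1 := hid.2 u
    have e2 := hid.2 v
    exact ((mem_nbrs G).1 hu).ne (hid.1 (by omega))
  rw [h0] at h2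
  rw [Nat.le_div_iff_mul_le (by omega)]
  have hq0 : (0 : ℝ) < q := by exact_mod_cast hq
  have hP0 : (16 : ℝ) * q < primeSeq q 0 := by exact_mod_cast (primeSeq_zero_spec hq).2.1
  have h5 : (0 : ℝ) ≤ 2 * Δ / primeSeq q (Nat.clog 2 n) := by positivity
  have h6 : 4 * (Δ : ℝ) / primeSeq q 0 ≤ Δ / q := by
    rw [div_le_div_iff₀ (by linarith) hq0]
    have : (0 : ℝ) ≤ Δ := Nat.cast_nonneg _
    nlinarith
  have h7 := h2.trans (by simp only [Finset.card_empty, Nat.cast_zero]; linarith :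
    _ ≤ (Δ : ℝ) / q)
  rw [le_div_iff₀ hq0] at h7
  exact_mod_cast h7

theorem clog_le_logb {n : ℕ} (hn : 2 ≤ n) : (Nat.clog 2 n : ℝ) ≤ Real.logb 2 n + 1 := by
  have h1 : 1 ≤ Nat.clog 2 n := Nat.clog_pos (by norm_num) hn
  have h2 : 2 ^ (Nat.clog 2 n - 1) < n := Nat.pow_pred_clog_lt_self (by norm_num) hn
  have h3 : ((Nat.clog 2 n - 1 : ℕ) : ℝ) ≤ Real.logb 2 n := by
    rw [Real.le_logb_iff_rpow_le (by norm_num) (by positivity), Real.rpow_natCast]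
    exact_mod_cast h2.le
  rw [Nat.cast_sub h1] at h3
  push_cast at h3
  linarith

/-! ### Computing a legal coloring -/

/-- The least positive number that does not occur in `M`. -/
def leastFree (M : Multiset ℕ) : ℕ := sInf {c | 1 ≤ c ∧ c ∉ M}

/-- An entry `0` comes from a vertex that has not selected yet and blocks no color; the rest is
pigeonhole. -/
theorem exists_free_le {M : Multiset ℕ} {A : ℕ} (h : (M.filter fun c => c ≠ 0).card ≤ A) :
    ∃ c ≤ A + 1, 1 ≤ c ∧ c ∉ M := by
  by_contra! hc
  have hsub : Finset.Icc 1 (A + 1) ⊆ (M.filter fun c => c ≠ 0).toFinset := by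
    intro c hc'
    rw [Finset.mem_Icc] at hc'
    simp only [Multiset.mem_toFinset, Multiset.mem_filter]
    exact ⟨hc c hc'.2 hc'.1, by omega⟩
  have h1 := (Finset.card_le_card hsub).trans (Multiset.toFinset_card_le _)
  rw [Nat.card_Icc] at h1
  omega

theorem leastFree_spec (M : Multiset ℕ) : 1 ≤ leastFree M ∧ leastFree M ∉ M := by
  obtain ⟨c, -, hc⟩ := exists_free_le (le_refl (M.filter fun c => c ≠ 0).card)
  exact Nat.sInf_mem (s := {c | 1 ≤ c ∧ c ∉ M}) ⟨c, hc⟩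

theorem leastFree_le {M : Multiset ℕ} {A : ℕ} (h : (M.filter fun c => c ≠ 0).card ≤ A) :
    leastFree M ≤ A + 1 := by
  obtain ⟨c, hc, hc'⟩ := exists_free_le h
  exact (Nat.sInf_le (s := {c | 1 ≤ c ∧ c ∉ M}) hc').trans hc

/-! ### Greedy coloring in prescribed time slots -/

/-- Sequential greedy coloring for `K` rounds. The input of a vertex is the number of the round in
which it selects the least positive color that its neighbours have not selected. -/
def greedy (K : ℕ) : Algorithm ℕ ℕ :=
  ((Algorithm.loop (fun s : ℕ × ℕ × ℕ => s.2.2)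
    (fun s M => (s.1 + 1, s.2.1, if s.2.1 = s.1 then leastFree M else s.2.2)) K).seq
      (Algorithm.ofFun fun x => x.2.2.2)).comap fun i => (0, i, 0)

section Greedy

variable {V : Type} [Fintype V] (G : SimpleGraph V) (slot : V → ℕ)

/-- The selections after `r` rounds of greedy coloring. -/
def greedyColor : ℕ → V → ℕ
  | 0, _ => 0
  | r + 1, v =>
      if slot v = r then leastFree ((nbrs G v).val.map (greedyColor r)) else greedyColor r v

theorem run_greedy (K : ℕ) : (greedy K).run G slot = greedyColor G slot K := by
  have key : ∀ r, (stepAll G (fun s : ℕ × ℕ × ℕ => s.2.2)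
      (fun s M => (s.1 + 1, s.2.1, if s.2.1 = s.1 then leastFree M else s.2.2)))^[r]
      (fun v => (0, slot v, 0)) = fun v => (r, slot v, greedyColor G slot r v) := by
    intro r
    induction r with
    | zero => rfl
    | succ r ih =>
      rw [Function.iterate_succ_apply', ih]
      rfl
  simp [greedy, key]

variable {G slot}

theorem greedyColor_of_le {r : ℕ} {v : V} (h : r ≤ slot v) : greedyColor G slot r v = 0 := by
  induction r with
  | zero => rfl
  | succ r ih => rw [greedyColor, if_neg (by omega), ih (by omega)]

theorem greedyColor_of_lt {r : ℕ} {v : V} (h : slot v < r) :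
    greedyColor G slot r v = leastFree ((nbrs G v).val.map (greedyColor G slot (slot v))) := by
  induction r, h using Nat.le_induction with
  | base => rw [greedyColor, if_pos rfl]
  | succ r hr ih => rw [greedyColor, if_neg (by omega), ih]

/-- The endpoint with the later slot sees the selection of the other one, which is already final,
and avoids it. -/
theorem run_greedy_ne {K : ℕ} (hK : ∀ v, slot v < K) {u v : V} (huv : G.Adj u v)
    (hslot : slot u ≠ slot v) : (greedy K).run G slot u ≠ (greedy K).run G slot v := by
  wlog h : slot u < slot v generalizing u v
  · exact (this huv.symm hslot.symm (by omega)).symm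
  rw [run_greedy, greedyColor_of_lt (hK v)]
  intro he
  refine (leastFree_spec ((nbrs G v).val.map (greedyColor G slot (slot v)))).2 ?_
  rw [← he]
  refine Multiset.mem_map.2 ⟨u, (mem_nbrs G).2 huv.symm, ?_⟩
  rw [greedyColor_of_lt h, greedyColor_of_lt (hK u)]

theorem run_greedy_bounds {K A : ℕ} (hK : ∀ v, slot v < K) (v : V)
    (hA : ((nbrs G v).filter fun u => slot u < slot v).card ≤ A) :
    1 ≤ (greedy K).run G slot v ∧ (greedy K).run G slot v ≤ A + 1 := by
  rw [run_greedy, greedyColor_of_lt (hK v)]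
  refine ⟨(leastFree_spec _).1, leastFree_le ?_⟩
  rw [card_filter_map_val]
  refine le_trans (Finset.card_le_card fun u hu => ?_) hA
  rw [Finset.mem_filter] at hu ⊢
  exact ⟨hu.1, by by_contra h; exact hu.2 (greedyColor_of_le (by omega))⟩

end Greedy

/-! ### Block-wise color reduction and the legal coloring -/

/-- One phase of the Kuhn-Wattenhofer color reduction: each block of `2 B` colors is reduced to `B`
colors by greedy coloring. -/
def halve (B : ℕ) : Algorithm ℕ ℕ :=
  ((greedy (2 * B)).within.comap fun c : ℕ => (c / (2 * B), c % (2 * B))).seq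
    (Algorithm.ofFun fun x => x.1 / (2 * B) * B + (x.2 - 1))

/-- The Kuhn-Wattenhofer color reduction with `j` phases. -/
def halveIter (B : ℕ) : ℕ → Algorithm ℕ ℕ
  | 0 => Algorithm.ofFun id
  | j + 1 => (halve B).seq ((halveIter B j).comap Prod.snd)

@[simp] theorem rounds_halveIter (B j : ℕ) : (halveIter B j).rounds = j * (2 * B) := by
  induction j with
  | zero => simp [halveIter]
  | succ j ih =>
    have : (halve B).rounds = 2 * B := by
      simp [halve, greedy]
    simp [halveIter, ih, this]
    ring

section Halve

variable {V : Type} [Fintype V] {G : SimpleGraph V}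

/-- Within a block the old color modulo `2 * B` serves as the slot, and `B` colors suffice since
degrees are below `B`. Different blocks receive disjoint ranges of new colors. -/
theorem run_halve_spec {B : ℕ} (hdeg : ∀ v, (nbrs G v).card < B) {c : V → ℕ}
    (hc : ∀ u v, G.Adj u v → c u ≠ c v) {N : ℕ} (hN : ∀ v, c v < 2 * B * N) :
    (∀ v, (halve B).run G c v < B * N) ∧
      ∀ u v, G.Adj u v → (halve B).run G c u ≠ (halve B).run G c v := by
  set H := sameLabel G fun v => c v / (2 * B) with hH
  set slot : V → ℕ := fun v => c v % (2 * B) with hslot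
  have hrun : ∀ v, (halve B).run G c v =
      c v / (2 * B) * B + ((greedy (2 * B)).run H slot v - 1) := fun v => by simp [halve, hH, hslot]
  have hK : ∀ v, slot v < 2 * B := fun v => Nat.mod_lt _ (by have := hdeg v; omega)
  have hb : ∀ v, 1 ≤ (greedy (2 * B)).run H slot v ∧ (greedy (2 * B)).run H slot v ≤ B := by
    intro v
    have h0 := hdeg v
    have h1 : ((nbrs H v).filter fun u => slot u < slot v).card ≤ B - 1 := by
      have : ((nbrs H v).filter fun u => slot u < slot v).card ≤ (nbrs G v).card := by
        refine Finset.card_le_card fun u hu => ?_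
        simp only [Finset.mem_filter, mem_nbrs, hH, sameLabel_adj] at hu ⊢
        exact hu.1.1
      omega
    have h2 := run_greedy_bounds hK v h1
    omega
  refine ⟨fun v => ?_, fun u v huv => ?_⟩
  · rw [hrun]
    have h1 := hb v
    have h2 : c v / (2 * B) < N := Nat.div_lt_of_lt_mul (hN v)
    have h3 := Nat.mul_le_mul_right B (Nat.succ_le_of_lt h2)
    have h4 := hdeg v
    rw [Nat.succ_mul, mul_comm N] at h3
    omega
  · rw [hrun, hrun]
    intro he
    have h1 := hb u
    have h2 := hb v
    have hBpos : 0 < B := by omega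
    have e1 : c u / (2 * B) = c v / (2 * B) := by
      have hdiv : ∀ x y : ℕ, y < B → (x * B + y) / B = x := by
        intro x y hy
        rw [mul_comm, Nat.mul_add_div hBpos, Nat.div_eq_of_lt hy, add_zero]
      rw [← hdiv (c u / (2 * B)) ((greedy (2 * B)).run H slot u - 1) (by omega), he,
        hdiv _ _ (by omega)]
    have hHadj : H.Adj u v := ⟨huv, e1⟩
    refine run_greedy_ne hK hHadj (fun e => ?_) (by rw [e1] at he; omega)
    refine hc u v huv ?_
    rw [← Nat.div_add_mod (c u) (2 * B), ← Nat.div_add_mod (c v) (2 * B), e1]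
    exact congrArg _ e

theorem run_halveIter_spec {B : ℕ} (hdeg : ∀ v, (nbrs G v).card < B) (j : ℕ) {c : V → ℕ}
    (hc : ∀ u v, G.Adj u v → c u ≠ c v) (hN : ∀ v, c v < B * 2 ^ j) :
    (∀ v, (halveIter B j).run G c v < B) ∧
      ∀ u v, G.Adj u v → (halveIter B j).run G c u ≠ (halveIter B j).run G c v := by
  induction j generalizing c with
  | zero => exact ⟨fun v => by simpa [halveIter] using hN v, fun u v huv => by simpa [halveIter] using hc u v huv⟩
  | succ j ih =>
    have h := run_halve_spec hdeg hc (N := 2 ^ j) fun v => (hN v).trans_eq (by ring)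
    simpa [halveIter] using ih h.2 h.1

end Halve

/-- An algorithm for legal coloring, where `A` bounds the number of neighbours in the sets of the
`H`-partition with the same or a greater index, and `T` bounds the number of these sets. -/
def legalAlg (n A T : ℕ) : Algorithm ℕ ℕ :=
  (peel A T).seq
    (((halveIter (A + 1) (Nat.clog 2 n)).within.comap fun x : ℕ × ℕ => (x.2, x.1 - 1)).seq
      ((greedy (T * (A + 1))).comap fun x => (T - x.1.2) * (A + 1) + x.2))

/-- Every `H`-set has maximum degree at most `A`, so it is first reduced to `A + 1` auxiliary
colors. The greedy pass has one slot per pair of `H`-set and auxiliary color, with the greatest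
`H`-index first. Neighbours with earlier slots thus have at least the same `H`-index, and there are
at most `A` of them; equal slots mean equal set and color, which never happens along an edge. -/
theorem run_legalAlg_spec {V : Type} [Fintype V] (G : SimpleGraph V) {ident : V → ℕ}
    (hid : IsIdentity ident) {A T : ℕ} (hT : ∀ v, peelIndex G A T v ≠ 0) :
    (∀ v, 1 ≤ (legalAlg (Fintype.card V) A T).run G ident v ∧
      (legalAlg (Fintype.card V) A T).run G ident v ≤ A + 1) ∧
    ∀ u v, G.Adj u v → (legalAlg (Fintype.card V) A T).run G ident u ≠
      (legalAlg (Fintype.card V) A T).run G ident v := by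
  set n := Fintype.card V with hn
  set h := peelIndex G A T with hh
  set c := (halveIter (A + 1) (Nat.clog 2 n)).run (sameLabel G h)
    (fun v => ident v - 1) with hc
  set slot : V → ℕ := fun v => (T - h v) * (A + 1) + c v with hslot
  have hrun : (legalAlg n A T).run G ident = (greedy (T * (A + 1))).run G slot := by
    simp only [legalAlg, Algorithm.run_seq, run_peel, Algorithm.run_comap, Algorithm.run_within]
    rfl
  have hhigh : ∀ v, ((nbrs G v).filter fun u => h v ≤ h u).card ≤ A :=
    fun v => card_higher_le_of_peelIndex_ne_zero (hT v)
  have hle : ∀ v, h v ≤ T := fun v => by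
    obtain ⟨s, hs, h1, -⟩ := exists_of_peelIndex_ne_zero (hT v)
    rw [hh]
    omega
  have hdeg : ∀ v, (nbrs (sameLabel G h) v).card < A + 1 := by
    intro v
    refine Nat.lt_succ_of_le (le_trans (Finset.card_le_card fun u hu => ?_) (hhigh v))
    simp only [Finset.mem_filter, mem_nbrs, sameLabel_adj] at hu ⊢
    exact ⟨hu.1, hu.2.le⟩
  have hspec := run_halveIter_spec hdeg (Nat.clog 2 n) 
    (c := fun v => ident v - 1)
    (fun u v huv he => huv.ne (hid.1 (by have := hid.2 u; have := hid.2 v; omega))) (fun v => by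
      have h1 := hid.2 v
      have h2 : n ≤ 2 ^ Nat.clog 2 n := Nat.le_pow_clog (by norm_num) _
      have h3 := Nat.le_mul_of_pos_left (2 ^ Nat.clog 2 n) (by omega : 0 < A + 1)
      omega)
  rw [← hc] at hspec
  -- Here `h v ≥ 1` matters: the slots of index `0` would come after the last round.
  have hK : ∀ v, slot v < T * (A + 1) := by
    intro v
    have h1 := hspec.1 v
    have h2 : T - h v + 1 ≤ T := by
      have := hT v
      have := hle v
      omega
    calc slot v < (T - h v + 1) * (A + 1) := by simp only [hslot]; linarith
      _ ≤ T * (A + 1) := Nat.mul_le_mul_right _ h2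
  rw [hrun]
  refine ⟨fun v => run_greedy_bounds hK v (le_trans (Finset.card_le_card fun u hu => ?_) (hhigh v)),
    fun u v huv => run_greedy_ne hK huv fun he => ?_⟩
  · rw [Finset.mem_filter] at hu ⊢
    refine ⟨hu.1, ?_⟩
    by_contra hlt
    have h1 := hspec.1 v
    have h2 : T - h v + 1 ≤ T - h u := by
      have := hle v
      omega
    have h3 := Nat.mul_le_mul_right (A + 1) h2
    have h4 := hu.2
    simp only [hslot] at h4
    linarith
  · simp only [hslot] at he
    have hu := hspec.1 u
    have hv := hspec.1 v
    have e1 : T - h u = T - h v := by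
      have hdiv : ∀ x y : ℕ, y < A + 1 → (x * (A + 1) + y) / (A + 1) = x := by
        intro x y hy
        rw [mul_comm, Nat.mul_add_div (Nat.succ_pos A), Nat.div_eq_of_lt hy, add_zero]
      rw [← hdiv (T - h u) _ hu, he, hdiv _ _ hv]
    have e2 : h u = h v := by
      have := hle u
      have := hle v
      omega
    exact hspec.2 u v ⟨huv, e2⟩ (by rw [e1] at he; omega)

/-! ### Existence of admissible subroutines -/

/-- A collection of admissible subroutines. -/
def subroutines (ε : ℝ) : Subroutines where
  hPartition n α := peel ⌊(2 + ε) * α⌋₊ (peelRounds ε n)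
  hCount n _ := peelRounds ε n
  defective n _ q := defectiveAlg n q
  defectiveCount _ _ q := primeSeq q 0 ^ 2
  legal n α := legalAlg n ⌊(2 + ε) * α⌋₊ (peelRounds ε n)

theorem exists_admissible {ε : ℝ} (hε : 0 < ε) :
    ∃ (S : Subroutines) (c : ℝ), S.Admissible ε c := by
  set c₀ : ℝ := (Real.logb 2 (1 + ε / 2))⁻¹ + 1 with hc₀
  have hc₀pos : 0 ≤ c₀ := by
    have : 0 ≤ Real.logb 2 (1 + ε / 2) := Real.logb_nonneg (by norm_num) (by linarith)
    positivity
  have hpeel : ∀ (V : Type) [Fintype V] (G : SimpleGraph V) (α : ℕ), 2 ≤ Fintype.card V →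
      1 ≤ α → arboricity G ≤ α →
      ∀ v, peelIndex G ⌊(2 + ε) * α⌋₊ (peelRounds ε (Fintype.card V)) v ≠ 0 :=
    fun V _ G α hV hα hG => peelIndex_ne_zero hε hα hG (lt_pow_peelRounds hε (by omega))
  -- The term `1024 = 32 ^ 2` covers the defective colors (and its rounds), `c₀` the peeling, `4 *
  -- (3 + ε)` the block-wise reduction, and `c₀ * (3 + ε)` the greedy pass.
  set c : ℝ := 1024 + c₀ + 4 * (3 + ε) + c₀ * (3 + ε) with hc
  refine ⟨subroutines ε, c, ?_, ?_, ?_, ?_, ?_, ?_⟩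
  · intro V _ G ident α hV hid hα hG v
    classical
    have h0 := hpeel V G α hV hα hG v
    obtain ⟨s, hs, h1, -⟩ := exists_of_peelIndex_ne_zero h0
    have hrun : ((subroutines ε).hPartition (Fintype.card V) α).run G ident =
        peelIndex G ⌊(2 + ε) * α⌋₊ (peelRounds ε (Fintype.card V)) := run_peel G _ _ _
    rw [hrun]
    refine ⟨by omega, ?_, le_trans (Finset.card_le_card fun u hu => ?_)
      (card_higher_le_of_peelIndex_ne_zero h0)⟩
    · rw [h1]
      exact hs
    · have hu' := (Finset.mem_filter.1 hu).2
      exact Finset.mem_filter.2 ⟨(mem_nbrs G).2 hu'.1, hu'.2⟩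
  · intro n α hn hα
    have h1 := one_le_logb hn
    have h2 := peelRounds_le hε hn
    have h3 : c₀ * Real.logb 2 n ≤ c * Real.logb 2 n := by
      refine mul_le_mul_of_nonneg_right ?_ (by linarith)
      have : 0 ≤ c₀ * (3 + ε) := by positivity
      rw [hc]
      linarith
    exact ⟨h2.trans h3, by simpa [subroutines, peel] using h2.trans h3⟩
  · intro V _ G ident Δ q hV hid hq hΔ v
    classical
    have h := run_defectiveAlg_spec G hid hq (Δ := Δ) (fun v => by simpa only [nbrs] using hΔ v) v
    refine ⟨h.1, h.2.1, le_trans (Finset.card_le_card fun u hu => ?_) h.2.2⟩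
    have hu' := (Finset.mem_filter.1 hu).2
    exact Finset.mem_filter.2 ⟨(mem_nbrs G).2 hu'.1, hu'.2⟩
  · intro n Δ q hn hq
    have h1 := one_le_logb hn
    have hε3 : 0 ≤ c₀ * (3 + ε) := by positivity
    constructor
    · have h2 : (primeSeq q 0 : ℝ) ≤ 32 * q := by exact_mod_cast (primeSeq_zero_spec hq).2.2
      have h3 : (primeSeq q 0 : ℝ) ^ 2 ≤ (32 * q) ^ 2 := by gcongr
      have h4 : 1024 * (q : ℝ) ^ 2 ≤ c * q ^ 2 := by
        refine mul_le_mul_of_nonneg_right ?_ (by positivity)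
        rw [hc]
        linarith
      simp only [subroutines]
      push_cast
      linarith
    · have h2 := clog_le_logb hn
      have h3 : ((subroutines ε).defective n Δ q).rounds = Nat.clog 2 n + 1 := by
        simp [subroutines, defectiveAlg, reduceLoop]
      rw [h3]
      push_cast
      have h4 : 3 * Real.logb 2 n ≤ c * Real.logb 2 n := by
        refine mul_le_mul_of_nonneg_right ?_ (by linarith)
        rw [hc]
        linarith
      linarith
  · intro V _ G ident α hV hid hα hG
    exact run_legalAlg_spec G hid (hpeel V G α hV hα hG)
  · intro n α hn hα
    have h1 := one_le_logb hn
    have h2 := peelRounds_le hε hn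
    have h3 := clog_le_logb hn
    have hα1 : (1 : ℝ) ≤ α := by exact_mod_cast hα
    have hA : ((⌊(2 + ε) * α⌋₊ + 1 : ℕ) : ℝ) ≤ (3 + ε) * α := by
      have := Nat.floor_le (by positivity : 0 ≤ (2 + ε) * α)
      push_cast
      linarith
    have h4 : ((subroutines ε).legal n α).rounds = peelRounds ε n * (⌊(2 + ε) * α⌋₊ + 1) +
        Nat.clog 2 n * (2 * (⌊(2 + ε) * α⌋₊ + 1)) + peelRounds ε n := by
      simp [subroutines, legalAlg, greedy, peel]
    rw [h4]
    set B : ℕ := ⌊(2 + ε) * α⌋₊ + 1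
    set L := Real.logb 2 n
    push_cast
    have hB0 : (0 : ℝ) ≤ B := Nat.cast_nonneg _
    have e1 : (peelRounds ε n : ℝ) * B ≤ (c₀ * L) * ((3 + ε) * α) := by
      gcongr
    have e2 : (Nat.clog 2 n : ℝ) * (2 * B) ≤ (2 * L) * (2 * ((3 + ε) * α)) := by
      gcongr
      linarith
    have e3 : c₀ * L ≤ c₀ * L * α := le_mul_of_one_le_right (by positivity) hα1
    have e4 : 0 ≤ 1024 * α * L := by positivity
    rw [hc]
    linarith

/-! ### Procedure Arbdefective-Coloring -/

/-- For `k ≥ 1` the range is nonempty, so the default value in `leastUsed` plays no role. -/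
theorem leastUsed_mem {k : ℕ} (hk : 1 ≤ k) (cs : Multiset ℕ) :
    leastUsed k cs ∈ (List.range' 1 k).argmin fun i => cs.count i := by
  rw [leastUsed]
  cases h : (List.range' 1 k).argmin fun i => cs.count i with
  | none =>
    rw [List.argmin_eq_none] at h
    simp at h
    omega
  | some i => simp

theorem leastUsed_bounds {k : ℕ} (hk : 1 ≤ k) (cs : Multiset ℕ) :
    1 ≤ leastUsed k cs ∧ leastUsed k cs ≤ k := by
  have h := List.argmin_mem (leastUsed_mem hk cs)
  rw [List.mem_range'_1] at h
  omega

/-- The minimum of the `k` counts is at most their average. -/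
theorem count_leastUsed_le {k : ℕ} (hk : 1 ≤ k) (cs : Multiset ℕ) :
    cs.count (leastUsed k cs) ≤ cs.card / k := by
  rw [Nat.le_div_iff_mul_le (by omega)]
  calc cs.count (leastUsed k cs) * k
      = ∑ _i ∈ Finset.Icc 1 k, cs.count (leastUsed k cs) := by simp [mul_comm]
    _ ≤ ∑ i ∈ Finset.Icc 1 k, cs.count i := by
        refine Finset.sum_le_sum fun i hi => ?_
        rw [Finset.mem_Icc] at hi
        exact List.le_of_mem_argmin (f := fun i => cs.count i)
          (List.mem_range'_1.2 (by omega)) (leastUsed_mem hk cs)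
    _ ≤ ∑ i ∈ Finset.Icc 1 k ∪ cs.toFinset, cs.count i :=
        Finset.sum_le_sum_of_subset Finset.subset_union_left
    _ = cs.card := Multiset.sum_count_eq_card fun a ha => by simp [ha]

/-! ### Selecting colors along an acyclic orientation -/

section Select

variable {V : Type}

open Classical in
/-- The selections of the vertices after `r` rounds, when `par v` is the set of the parents
of `v`. -/
def selColor (k : ℕ) (par : V → Finset V) : ℕ → V → ℕ
  | 0, _ => 0
  | r + 1, v =>
      if selColor k par r v ≠ 0 then selColor k par r v
      else if ∀ u ∈ par v, selColor k par r u ≠ 0 then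
        leastUsed k ((par v).val.map (selColor k par r))
      else 0

variable {k : ℕ} {par : V → Finset V}

theorem selColor_of_ne_zero {r : ℕ} {v : V} (h : selColor k par r v ≠ 0) :
    selColor k par (r + 1) v = selColor k par r v := by
  rw [selColor, if_pos h]

/-- A vertex selects only after all its parents, and selections never change, so its color remains
least used with respect to the current colors of the parents. The induction has to carry along that
all parents have selected. -/
theorem selColor_eq_leastUsed {r : ℕ} {v : V} (h : selColor k par r v ≠ 0) :
    selColor k par r v = leastUsed k ((par v).val.map (selColor k par r)) := by
  suffices hs : (∀ u ∈ par v, selColor k par r u ≠ 0) ∧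
      selColor k par r v = leastUsed k ((par v).val.map (selColor k par r)) from hs.2
  induction r with
  | zero => exact absurd rfl h
  | succ r ih =>
    have key : (∀ u ∈ par v, selColor k par r u ≠ 0) ∧
        selColor k par (r + 1) v = leastUsed k ((par v).val.map (selColor k par r)) := by
      by_cases h0 : selColor k par r v ≠ 0
      · rw [selColor_of_ne_zero h0]
        exact ih h0
      · rw [selColor, if_neg h0] at h ⊢
        by_cases h1 : ∀ u ∈ par v, selColor k par r u ≠ 0
        · exact ⟨h1, by rw [if_pos h1]⟩
        · rw [if_neg h1] at h
          exact absurd rfl h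
    refine ⟨fun u hu => ?_, ?_⟩
    · rw [selColor_of_ne_zero (key.1 u hu)]
      exact key.1 u hu
    · rw [key.2]
      congr 1
      exact Multiset.map_congr rfl fun u hu => (selColor_of_ne_zero (key.1 u hu)).symm

theorem selColor_ne_zero (hk : 1 ≤ k) (depth : V → ℕ)
    (hdepth : ∀ v, ∀ u ∈ par v, depth u < depth v) {r : ℕ} {v : V} (h : depth v < r) :
    selColor k par r v ≠ 0 := by
  induction r generalizing v with
  | zero => omega
  | succ r ih =>
    by_cases h0 : selColor k par r v ≠ 0
    · rwa [selColor_of_ne_zero h0]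
    · rw [selColor, if_neg h0, if_pos fun u hu => ih (by have := hdepth v u hu; omega)]
      have := leastUsed_bounds hk ((par v).val.map (selColor k par r))
      omega

variable [Fintype V] (G : SimpleGraph V)

/-- Parents are neighbours and identities are distinct, so the filter keeps one message for each
parent that has selected; the comparison of cardinalities tests whether all of them have. -/
theorem select_eq {ident : V → ℕ} (hid : Function.Injective ident)
    (hpar : ∀ v, par v ⊆ nbrs G v) (r : ℕ) (v : V) :
    select k ((par v).image ident) (selColor k par r v)
      ((nbrs G v).val.map fun u => Nat.pair (ident u) (selColor k par r u)) =
      selColor k par (r + 1) v := by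
  classical
  have hR : (((nbrs G v).val.map fun u => Nat.pair (ident u) (selColor k par r u)).filter
      fun m => m.unpair.1 ∈ (par v).image ident ∧ m.unpair.2 ≠ 0) =
      ((par v).filter fun u => selColor k par r u ≠ 0).val.map
        fun u => Nat.pair (ident u) (selColor k par r u) := by
    rw [Multiset.filter_map, ← Finset.filter_val]
    congr 2
    ext u
    simp only [Finset.mem_filter, Function.comp_apply, Nat.unpair_pair, Finset.mem_image,
      hid.eq_iff, exists_eq_right]
    exact ⟨fun h => h.2, fun h => ⟨hpar v h.1, h⟩⟩
  rw [selColor, select, hR]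
  by_cases h0 : selColor k par r v ≠ 0
  · rw [if_pos h0, if_pos h0]
  · rw [if_neg h0, if_neg h0]
    simp only [Multiset.card_map, Finset.card_val, Finset.card_image_of_injective _ hid,
      Finset.card_filter_eq_iff, Multiset.map_map, Function.comp_def, Nat.unpair_pair]
    by_cases h1 : ∀ u ∈ par v, selColor k par r u ≠ 0
    · rw [if_pos h1, if_pos h1, Finset.filter_true_of_mem h1]
    · rw [if_neg h1, if_neg h1]

theorem run_simpleArbdefective {ident : V → ℕ} (hid : Function.Injective ident)
    (hpar : ∀ v, par v ⊆ nbrs G v) (L : ℕ) :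
    (simpleArbdefective k L).run G (fun v => (ident v, (par v).image ident)) =
      selColor k par (L + 1) := by
  have hloop : ∀ r, exec G L (fun v =>
      simpleArbdefectiveLoop k (ident v) ((par v).image ident) L (selColor k par r v)) =
      selColor k par (L + r) := by
    induction L with
    | zero => intro r; rw [Nat.zero_add]; rfl
    | succ L ih =>
      intro r
      rw [exec_succ]
      simp only [simpleArbdefectiveLoop]
      rw [show L + 1 + r = L + (r + 1) by ring, ← ih (r + 1)]
      congr 1
      funext v
      rw [← select_eq G hid hpar]
  -- The local step before the first round lets the vertices without parents select, which is why
  -- `L` rounds reach stage `L + 1`.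
  have hinit : ∀ v, select k ((par v).image ident) 0 0 = selColor k par 1 v := by
    intro v
    classical
    simp only [select, selColor, Multiset.filter_zero, Multiset.card_zero, Multiset.map_zero,
      Finset.card_image_of_injective _ hid]
    by_cases hv : par v = ∅
    · simp [hv]
    · have h1 : ¬ (0 = (par v).card) := fun e => hv (Finset.card_eq_zero.1 e.symm)
      obtain ⟨u, hu⟩ := Finset.nonempty_iff_ne_empty.2 hv
      simp only [ne_eq, not_true_eq_false, if_false, if_neg h1]
      rw [if_neg fun h => h u hu]
  rw [← hloop 1]
  simp only [← hinit]
  rfl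

end Select

/-! ### The arboricity of the color classes after one phase -/

section Arbdefective

variable {V : Type} [Fintype V] (G : SimpleGraph V)

/-- The neighbours of `v` towards which an edge is oriented, for `H`-indices `h` and colors `φ`. -/
def orientedParents (h φ : V → ℕ) (v : V) : Finset V :=
  (nbrs G v).filter fun u => h v < h u ∨ (h v = h u ∧ φ v < φ u)

theorem run_orient (ident h φ : V → ℕ) (v : V) :
    orient.run G (fun v => ((ident v, h v), φ v)) v = (orientedParents G h φ v).image ident := by
  have hrun : orient.run G (fun v => ((ident v, h v), φ v)) v =
      ((((nbrs G v).val.map fun u => Nat.pair (ident u) (Nat.pair (h u) (φ u))).filter fun m =>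
        h v < m.unpair.2.unpair.1 ∨
          (h v = m.unpair.2.unpair.1 ∧ φ v < m.unpair.2.unpair.2)).map
        fun m => m.unpair.1).toFinset := rfl
  rw [hrun]
  ext i
  simp [orientedParents]

/-- The first summand of the bound counts the parents that share the color of a vertex, the second
its unoriented edges. No other neighbour of its class lies above it in the order by rank and
identity. -/
theorem run_arbdefectiveColoring_spec {ε c : ℝ} (hε : 0 < ε) {S : Subroutines}
    (hS : S.Admissible ε c) {ident : V → ℕ} (hid : IsIdentity ident) (hV : 2 ≤ Fintype.card V)
    {α k t : ℕ} (hα : 1 ≤ α) (hG : arboricity G ≤ α) (hk : 1 ≤ k) (ht : 1 ≤ t) :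
    (∀ v, 1 ≤ (arbdefectiveColoring ε S (Fintype.card V) α k t).run G ident v ∧
      (arbdefectiveColoring ε S (Fintype.card V) α k t).run G ident v ≤ k) ∧
    arboricity (sameLabel G ((arbdefectiveColoring ε S (Fintype.card V) α k t).run G ident)) ≤
      ⌊(2 + ε) * α⌋₊ / k + ⌊(2 + ε) * α⌋₊ / defectParam ε t := by
  classical
  set n := Fintype.card V with hn
  set A := ⌊(2 + ε) * α⌋₊ with hA
  set q := defectParam ε t with hq
  have hq1 : 1 ≤ q := by
    have : (0 : ℝ) < (2 + ε) * t := by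
      have : (0 : ℝ) < t := by exact_mod_cast ht
      positivity
    exact Nat.ceil_pos.2 this
  set h := (S.hPartition n α).run G ident with hh
  have hspec : ∀ v, 1 ≤ h v ∧ h v ≤ S.hCount n α ∧
      ((nbrs G v).filter fun u => h v ≤ h u).card ≤ A := by
    intro v
    have h1 := hS.hPartition_spec V G ident α hV hid hα hG v
    refine ⟨h1.1, h1.2.1, le_trans (Finset.card_le_card fun u hu => ?_) h1.2.2⟩
    rw [Finset.mem_filter, mem_nbrs] at hu
    exact Finset.mem_filter.2 ⟨Finset.mem_univ u, hu⟩
  set φ := (S.defective n A q).run (sameLabel G h) ident with hφ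
  have hφspec : ∀ v, 1 ≤ φ v ∧ φ v ≤ S.defectiveCount n A q ∧
      ((nbrs (sameLabel G h) v).filter fun u => φ u = φ v).card ≤ A / q := by
    intro v
    have h1 := hS.defective_spec V (sameLabel G h) ident A q hV hid hq1 (fun w => by
      refine le_trans (Finset.card_le_card fun u hu => ?_) (hspec w).2.2
      have hu' := (Finset.mem_filter.1 hu).2
      rw [sameLabel_adj] at hu'
      exact Finset.mem_filter.2 ⟨(mem_nbrs G).2 hu'.1, hu'.2.le⟩) v
    refine ⟨h1.1, h1.2.1, le_trans (Finset.card_le_card fun u hu => ?_) h1.2.2⟩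
    rw [Finset.mem_filter, mem_nbrs] at hu
    exact Finset.mem_filter.2 ⟨Finset.mem_univ u, hu⟩
  set D := S.defectiveCount n A q with hD
  set par := orientedParents G h φ with hpar
  set L := pathBound ε S n α t with hL
  have hLD : L = S.hCount n α * D := rfl
  have hrun : (arbdefectiveColoring ε S n α k t).run G ident = selColor k par (L + 1) := by
    have h1 : (partialOrientation ε S n α t).run G ident = fun v => (par v).image ident := by
      funext v
      rw [hpar, ← run_orient]
      simp only [partialOrientation, Algorithm.run_seq, Algorithm.run_comap,
        Algorithm.run_within]
      rfl
    rw [arbdefectiveColoring, Algorithm.run_seq, h1]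
    exact run_simpleArbdefective G hid.1 (fun v => Finset.filter_subset _ _) L
  -- This encodes the lexicographic order of `H`-index and color; every parent has a greater rank.
  set rank : V → ℕ := fun v => h v * D + (φ v - 1) with hrank
  have hmono : ∀ u v, h u < h v → rank u < rank v := by
    intro u v huv
    have h1 := hφspec u
    have h2 := Nat.mul_le_mul_right D (Nat.succ_le_of_lt huv)
    rw [Nat.succ_mul] at h2
    simp only [hrank]
    omega
  have hrank_lt : ∀ v, ∀ u ∈ par v, rank v < rank u := by
    intro v u hu
    rcases (Finset.mem_filter.1 hu).2 with h1 | ⟨h1, h2⟩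
    · exact hmono v u h1
    · have := hφspec v
      simp only [hrank, h1]
      omega
  -- There are only `L` possible ranks, so the depth `L + D - rank v` is at most `L` and every
  -- vertex has selected by stage `L + 1`.
  have hrank_le : ∀ v, D ≤ rank v ∧ rank v < L + D := by
    intro v
    have h1 := hφspec v
    have h2 := Nat.mul_le_mul_right D (hspec v).1
    have h3 := Nat.mul_le_mul_right D (hspec v).2.1
    simp only [hrank, hLD]
    omega
  have hsel : ∀ v, selColor k par (L + 1) v ≠ 0 := by
    intro v
    refine selColor_ne_zero hk (fun v => L + D - rank v) (fun v u hu => ?_) ?_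
    · have h1 := hrank_lt v u hu
      have h2 := hrank_le u
      show L + D - rank u < L + D - rank v
      omega
    · have h2 := hrank_le v
      show L + D - rank v < L + 1
      omega
  rw [hrun]
  refine ⟨fun v => ?_, ?_⟩
  · rw [selColor_eq_leastUsed (hsel v)]
    exact leastUsed_bounds hk _
  · set j := selColor k par (L + 1) with hj
    -- Identities are at most `n`, so this key orders by rank and breaks ties by identity; it is
    -- injective even where the rank is not.
    refine arboricity_le_of_key _ (fun v => rank v * (n + 1) + ident v) (fun u v huv => ?_) _
      fun v => ?_
    · have h1 := congrArg (· % (n + 1)) huv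
      have hu := (hid.2 u).2
      have hv := (hid.2 v).2
      simp only [Nat.mul_add_mod'] at h1
      rw [Nat.mod_eq_of_lt (by omega), Nat.mod_eq_of_lt (by omega)] at h1
      exact hid.1 h1
    · have hsub : ((nbrs (sameLabel G j) v).filter fun u =>
          rank v * (n + 1) + ident v < rank u * (n + 1) + ident u) ⊆
          ((par v).filter fun u => j u = j v) ∪
          ((nbrs (sameLabel G h) v).filter fun u => φ u = φ v) := by
        intro u hu
        simp only [Finset.mem_filter, mem_nbrs, sameLabel_adj] at hu
        obtain ⟨⟨hadj, hjj⟩, hlt⟩ := hu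
        have hle : rank v ≤ rank u := by
          by_contra hcon
          have h1 := Nat.mul_le_mul_right (n + 1) (Nat.succ_le_of_lt (not_le.1 hcon))
          rw [Nat.succ_mul] at h1
          have := (hid.2 u).2
          omega
        rw [Finset.mem_union]
        by_cases hp : u ∈ par v
        · exact Or.inl (Finset.mem_filter.2 ⟨hp, hjj.symm⟩)
        · right
          have hp' : ¬ (h v < h u ∨ (h v = h u ∧ φ v < φ u)) := fun hc =>
            hp (Finset.mem_filter.2 ⟨(mem_nbrs G).2 hadj, hc⟩)
          have hhe : h v = h u := by
            by_contra hne
            have := hmono u v (by omega)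
            omega
          have h1 := hφspec u
          have h2 := hφspec v
          simp only [hrank, hhe] at hle
          exact Finset.mem_filter.2 ⟨(mem_nbrs _).2 ⟨hadj, hhe⟩, by omega⟩
      refine (Finset.card_le_card hsub).trans ((Finset.card_union_le _ _).trans
        (add_le_add ?_ (hφspec v).2.2))
      have hcount := count_leastUsed_le hk ((par v).val.map j)
      rw [← selColor_eq_leastUsed (hsel v), count_map_val, Multiset.card_map] at hcount
      refine hcount.trans (Nat.div_le_div_right (le_trans (Finset.card_le_card fun u hu => ?_)
        (hspec v).2.2))
      have hu' := Finset.mem_filter.1 hu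
      exact Finset.mem_filter.2 ⟨hu'.1, by omega⟩

/-- Since `defectParam ε p ≥ (2 + ε) p`, the second quotient is at most `α / p`. -/
theorem floor_div_add_le_nextArb {ε : ℝ} (hε : 0 < ε) (α : ℕ) {p : ℕ} (hp : 1 ≤ p) :
    ⌊(2 + ε) * α⌋₊ / p + ⌊(2 + ε) * α⌋₊ / defectParam ε p ≤ nextArb ε p α := by
  have hp0 : (0 : ℝ) < p := by exact_mod_cast hp
  have hA : (⌊(2 + ε) * α⌋₊ : ℝ) ≤ (2 + ε) * α := Nat.floor_le (by positivity)
  have hq : (2 + ε) * p ≤ (defectParam ε p : ℝ) := Nat.le_ceil _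
  refine Nat.le_floor ?_
  push_cast
  have h1 : ((⌊(2 + ε) * α⌋₊ / p : ℕ) : ℝ) ≤ (2 + ε) * α / p :=
    Nat.cast_div_le.trans (by gcongr)
  have h2 : ((⌊(2 + ε) * α⌋₊ / defectParam ε p : ℕ) : ℝ) ≤ α / p := by
    calc ((⌊(2 + ε) * α⌋₊ / defectParam ε p : ℕ) : ℝ)
        ≤ (⌊(2 + ε) * α⌋₊ : ℝ) / defectParam ε p := Nat.cast_div_le
      _ ≤ ((2 + ε) * α) / ((2 + ε) * p) := by gcongr
      _ = α / p := by field_simp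
  linarith

end Arbdefective

/-! ### Procedure Legal-Coloring -/

theorem Subroutines.Admissible.nonneg {ε c : ℝ} {S : Subroutines} (hS : S.Admissible ε c) :
    0 ≤ c := by
  have h1 := (hS.hPartition_bounds 2 1 le_rfl le_rfl).1
  have h2 : Real.logb 2 (2 : ℕ) = 1 := by simp
  rw [h2, mul_one] at h1
  exact (Nat.cast_nonneg _).trans h1

/-- The constant in the running time of Procedure Arbdefective-Coloring. -/
def phaseConst (ε c : ℝ) : ℝ := 2 * c + 1 + c * (c * (3 + ε) ^ 2)

/-- The factor `p ^ 2` comes from waiting for the parents: `O(log n)` `H`-sets times `O(p ^ 2)`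
defective colors. The other steps take `O(log n)` rounds. -/
theorem rounds_arbdefectiveColoring_le {ε c : ℝ} (hε : 0 < ε) {S : Subroutines}
    (hS : S.Admissible ε c) {n α p : ℕ} (hn : 2 ≤ n) (hα : 1 ≤ α) (hp : 1 ≤ p) :
    ((arbdefectiveColoring ε S n α p p).rounds : ℝ) ≤
      phaseConst ε c * p ^ 2 * Real.logb 2 n := by
  have hc := hS.nonneg
  have hL := one_le_logb hn
  set L := Real.logb 2 n
  set A := ⌊(2 + ε) * α⌋₊ with hA
  set q := defectParam ε p with hq
  have hp1 : (1 : ℝ) ≤ p := by exact_mod_cast hp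
  have hq1 : 1 ≤ q := Nat.ceil_pos.2 (by positivity)
  have hqle : (q : ℝ) ≤ (3 + ε) * p := by
    have := Nat.ceil_lt_add_one (by positivity : 0 ≤ (2 + ε) * (p : ℝ))
    rw [hq, defectParam]
    linarith
  have hr : (arbdefectiveColoring ε S n α p p).rounds =
      S.hCount n α * S.defectiveCount n A q +
        ((1 + (S.defective n A q).rounds) + (S.hPartition n α).rounds) := rfl
  rw [hr]
  push_cast
  obtain ⟨b1, b2⟩ := hS.hPartition_bounds n α hn hα
  obtain ⟨b3, b4⟩ := hS.defective_bounds n A q hn hq1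
  have e1 : (S.hCount n α : ℝ) * S.defectiveCount n A q ≤
      (c * L) * (c * ((3 + ε) * p) ^ 2) := by
    refine mul_le_mul b1 (b3.trans ?_) (Nat.cast_nonneg _) (by positivity)
    gcongr
  have hp2 : 1 ≤ (p : ℝ) ^ 2 := one_le_pow₀ hp1
  have e2 : (2 * c + 1) * L ≤ (2 * c + 1) * L * p ^ 2 :=
    le_mul_of_one_le_right (by positivity) hp2
  rw [phaseConst]
  nlinarith

/-! ### Iterating the phases -/

section Loop

variable {ε : ℝ} {p : ℕ}

theorem nextArb_le (hε : 0 < ε) (α : ℕ) : (nextArb ε p α : ℝ) ≤ (3 + ε) * α / p := by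
  refine (Nat.floor_le (by positivity)).trans (le_of_eq ?_)
  ring

/-- With this the second guard of the loop always holds, so the loop ends only when `α ≤ p`. -/
theorem nextArb_lt (hε : 0 < ε) (hp : 3 + ε < p) {α : ℕ} (hα : 1 ≤ α) : nextArb ε p α < α := by
  have h1 := nextArb_le (p := p) hε α
  have h2 : (3 + ε) * α / p < α := by
    have : (0 : ℝ) < α := by exact_mod_cast hα
    rw [div_lt_iff₀ (by linarith), mul_comm]
    gcongr
  exact_mod_cast h1.trans_lt h2

theorem one_le_nextArb (hε : 0 < ε) (hp : 3 + ε < p) {α : ℕ} (hα : p < α) :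
    1 ≤ nextArb ε p α := by
  refine Nat.le_floor ?_
  have h0 : (0 : ℝ) < p := by linarith
  have h1 : (1 : ℝ) ≤ α / p := by
    rw [le_div_iff₀ h0, one_mul]
    exact_mod_cast hα.le
  have h2 : 0 ≤ (2 + ε) * α / p := by positivity
  push_cast
  linarith

theorem sub_one_mul_add_lt {p a b i j : ℕ} (ha : 1 ≤ a) (hab : a < b) (hj : j ≤ p)
    (hi : 1 ≤ i) : (a - 1) * p + j < (b - 1) * p + i := by
  have h1 := Nat.mul_le_mul_right p (by omega : a - 1 + 1 ≤ b - 1)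
  rw [Nat.succ_mul] at h1
  omega

/-- The new index determines the old index and the color, so the new subgraphs are exactly the color
classes inside the old ones. -/
theorem sub_one_mul_add_eq_iff {p a b i j : ℕ} (ha : 1 ≤ a) (hb : 1 ≤ b) (hi : 1 ≤ i ∧ i ≤ p)
    (hj : 1 ≤ j ∧ j ≤ p) : (a - 1) * p + i = (b - 1) * p + j ↔ a = b ∧ i = j := by
  constructor
  · intro h
    rcases lt_trichotomy a b with hab | rfl | hab
    · exact absurd h (sub_one_mul_add_lt ha hab hi.2 hj.1).ne
    · exact ⟨rfl, by omega⟩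
    · exact absurd h (sub_one_mul_add_lt hb hab hj.2 hi.1).ne'
  · rintro ⟨rfl, rfl⟩
    rfl

/-- The output `out` colors each subgraph with label `z` legally from its own palette of `N`
colors. -/
def LegalPalettes {V : Type} (G : SimpleGraph V) (z : V → ℕ) (N : ℕ) (out : V → ℕ) : Prop :=
  (∀ v, (z v - 1) * N < out v ∧ out v ≤ z v * N) ∧
    ∀ u v, G.Adj u v → z u = z v → out u ≠ out v

/-- The palettes of the `p` parts of a subgraph tile one palette of size `p * N`, and edges between
different parts are legal because the palettes are disjoint. -/
theorem LegalPalettes.refine {V : Type} {G : SimpleGraph V} {z j : V → ℕ} {N : ℕ}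
    {out : V → ℕ} (hz : ∀ v, 1 ≤ z v) (hj : ∀ v, 1 ≤ j v ∧ j v ≤ p)
    (h : LegalPalettes G (fun v => (z v - 1) * p + j v) N out) :
    LegalPalettes G z (p * N) out := by
  refine ⟨fun v => ?_, fun u v huv _ he => ?_⟩
  · have h1 := h.1 v
    have h2 := hj v
    have h3 := hz v
    constructor
    · refine lt_of_le_of_lt ?_ h1.1
      rw [← mul_assoc]
      refine Nat.mul_le_mul_right N ?_
      show (z v - 1) * p ≤ (z v - 1) * p + j v - 1
      omega
    · refine h1.2.trans ?_
      rw [← mul_assoc]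
      refine Nat.mul_le_mul_right N ?_
      calc (z v - 1) * p + j v ≤ (z v - 1) * p + p := by omega
        _ = (z v - 1 + 1) * p := by ring
        _ = z v * p := by rw [Nat.sub_add_cancel h3]
  · have hlt : ∀ x y, (z x - 1) * p + j x < (z y - 1) * p + j y → out x < out y := by
      intro x y hxy
      refine (h.1 x).2.trans_lt (lt_of_le_of_lt ?_ (h.1 y).1)
      refine Nat.mul_le_mul_right N ?_
      show (z x - 1) * p + j x ≤ (z y - 1) * p + j y - 1
      omega
    rcases lt_trichotomy ((z u - 1) * p + j u) ((z v - 1) * p + j v) with h1 | h1 | h1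
    · exact (hlt u v h1).ne he
    · exact h.2 u v huv h1 he
    · exact (hlt v u h1).ne' he

/-- Here `i` counts the remaining phases and `N` is the palette size per current subgraph. A phase
turns `N` into `p * N` while `α` drops to at most `(3 + ε) α / p`, which costs one factor `3 + ε`.
The summand `c * p` is the final coloring, where `α ≤ p`. -/
theorem legalColoringLoop_spec {c : ℝ} (hε : 0 < ε) {S : Subroutines} (hS : S.Admissible ε c)
    {n : ℕ} (hn : 2 ≤ n) (hp : 3 + ε < p) (α : ℕ) (hα : 1 ≤ α) :
    ∃ i N : ℕ, ((p : ℝ) / (3 + ε)) ^ i ≤ α ∧ (N : ℝ) ≤ (3 + ε) ^ (i + 1) * α ∧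
      ((legalColoringLoop ε S n p α).rounds : ℝ) ≤
        (i * (phaseConst ε c * p ^ 2) + c * p) * Real.logb 2 n ∧
      ∀ (V : Type) [Fintype V] (G : SimpleGraph V) (ident z : V → ℕ), Fintype.card V = n →
        IsIdentity ident → (∀ v, 1 ≤ z v) → arboricity (sameLabel G z) ≤ α →
        LegalPalettes G z N
          ((legalColoringLoop ε S n p α).run G fun v => (z v, ident v)) := by
  induction α using Nat.strong_induction_on with
  | _ α ih =>
  have hc := hS.nonneg
  have hL := one_le_logb hn
  have hp0 : (0 : ℝ) < p := by linarith
  have hp1 : 1 ≤ p := by exact_mod_cast hp0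
  have hα1 : (1 : ℝ) ≤ α := by exact_mod_cast hα
  have hnext := nextArb_lt hε hp hα
  by_cases hαp : p < α
  · obtain ⟨i, N, h1, h2, h3, h4⟩ := ih _ hnext (one_le_nextArb hε hp hαp)
    have hle := nextArb_le (p := p) hε α
    have hunfold : legalColoringLoop ε S n p α = (arbdefectiveColoring ε S n α p p).within.seq
        ((legalColoringLoop ε S n p (nextArb ε p α)).comap
          fun x : (ℕ × ℕ) × ℕ => ((x.1.1 - 1) * p + x.2, x.1.2)) := by
      rw [legalColoringLoop, dif_pos ⟨hαp, hnext⟩]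
    refine ⟨i + 1, p * N, ?_, ?_, ?_, ?_⟩
    · calc ((p : ℝ) / (3 + ε)) ^ (i + 1) = (p / (3 + ε)) ^ i * (p / (3 + ε)) := pow_succ _ _
        _ ≤ ((3 + ε) * α / p) * (p / (3 + ε)) := by
            gcongr
            exact h1.trans hle
        _ = α := by field_simp
    · push_cast
      calc (p : ℝ) * N ≤ p * ((3 + ε) ^ (i + 1) * ((3 + ε) * α / p)) := by
            gcongr
            exact h2.trans (by gcongr)
        _ = (3 + ε) ^ (i + 1 + 1) * α := by
            rw [pow_succ (3 + ε) (i + 1)]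
            field_simp
    · have h5 := rounds_arbdefectiveColoring_le hε hS hn hα hp1
      rw [hunfold]
      simp only [Algorithm.rounds_seq, Algorithm.rounds_within, Algorithm.rounds_comap]
      push_cast
      linarith
    · intro V _ G ident z hV hid hz hG
      subst hV
      rw [hunfold]
      simp only [Algorithm.run_seq, Algorithm.run_within, Algorithm.run_comap]
      have h5 := run_arbdefectiveColoring_spec (sameLabel G z) hε hS hid hn hα hG hp1 hp1
      set j := (arbdefectiveColoring ε S (Fintype.card V) α p p).run (sameLabel G z) ident
      refine LegalPalettes.refine hz h5.1 ?_
      refine h4 V G ident (fun v => (z v - 1) * p + j v) rfl hid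
        (fun v => (h5.1 v).1.trans (Nat.le_add_left _ _)) ?_
      have hsame : sameLabel G (fun v => (z v - 1) * p + j v) =
          sameLabel (sameLabel G z) j := by
        ext u v
        simp only [sameLabel_adj, sub_one_mul_add_eq_iff (hz u) (hz v) (h5.1 u) (h5.1 v),
          and_assoc]
      rw [hsame]
      exact h5.2.trans (floor_div_add_le_nextArb hε α hp1)
  · have hunfold : legalColoringLoop ε S n p α = (S.legal n α).within.seq
        (Algorithm.ofFun fun x : (ℕ × ℕ) × ℕ =>
          (x.1.1 - 1) * (⌊(2 + ε) * α⌋₊ + 1) + x.2) := by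
      rw [legalColoringLoop, dif_neg (fun h => hαp h.1)]
    refine ⟨0, ⌊(2 + ε) * α⌋₊ + 1, by simpa using hα1, ?_, ?_, ?_⟩
    · have := Nat.floor_le (by positivity : 0 ≤ (2 + ε) * (α : ℝ))
      push_cast
      linarith
    · rw [hunfold]
      simp only [Algorithm.rounds_seq, Algorithm.rounds_within, Algorithm.rounds_ofFun, zero_add]
      refine (hS.legal_bounds n α hn hα).trans ?_
      have : (α : ℝ) ≤ p := by exact_mod_cast not_lt.1 hαp
      push_cast
      rw [zero_mul, zero_add]
      gcongr
    · intro V _ G ident z hV hid hz hG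
      subst hV
      rw [hunfold]
      simp only [Algorithm.run_seq, Algorithm.run_within, Algorithm.run_ofFun]
      obtain ⟨h5, h6⟩ := hS.legal_spec V (sameLabel G z) ident α hn hid hα hG
      refine ⟨fun v => ⟨Nat.lt_add_of_pos_right (h5 v).1, ?_⟩, fun u v huv hzz he => ?_⟩
      · have h7 := (h5 v).2
        have h8 : z v * (⌊(2 + ε) * α⌋₊ + 1) =
            (z v - 1) * (⌊(2 + ε) * α⌋₊ + 1) + (⌊(2 + ε) * α⌋₊ + 1) := by
          rw [← Nat.succ_mul, Nat.succ_eq_add_one, Nat.sub_add_cancel (hz v)]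
        rw [h8]
        exact Nat.add_le_add_left h7 _
      · refine h6 u v ⟨huv, hzz⟩ ?_
        simp only [hzz] at he
        exact Nat.add_left_cancel he

end Loop

theorem run_legalColoring_spec {ε c : ℝ} (hε : 0 < ε) {S : Subroutines}
    (hS : S.Admissible ε c) {p a : ℕ} (hp : 3 + ε < p) (ha : 1 ≤ a)
    {V : Type} [Fintype V] (G : SimpleGraph V) {ident : V → ℕ} (hid : IsIdentity ident)
    (hG : arboricity G = a) :
    ∃ i : ℕ, ((p : ℝ) / (3 + ε)) ^ i ≤ a ∧
      1 ≤ Real.logb 2 (Fintype.card V) ∧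
      ((legalColoring ε S (Fintype.card V) a p).rounds : ℝ) ≤
        (i * (phaseConst ε c * p ^ 2) + c * p) * Real.logb 2 (Fintype.card V) ∧
      (∀ u v, G.Adj u v → (legalColoring ε S (Fintype.card V) a p).run G ident u ≠
        (legalColoring ε S (Fintype.card V) a p).run G ident v) ∧
      ∀ v, 1 ≤ (legalColoring ε S (Fintype.card V) a p).run G ident v ∧
        ((legalColoring ε S (Fintype.card V) a p).run G ident v : ℝ) ≤
          (3 + ε) ^ (i + 1) * a := by
  -- Positive arboricity rules out graphs with at most one vertex, for which the subroutines promise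
  -- nothing.
  have hn : 2 ≤ Fintype.card V := by
    by_contra h
    have := arboricity_eq_zero_of_card_le_one G (by omega)
    omega
  obtain ⟨i, N, h1, h2, h3, h4⟩ := legalColoringLoop_spec hε hS hn hp a ha
  have hsame : sameLabel G (fun _ => 1) = G := by
    ext u v
    simp
  have h5 := h4 V G ident (fun _ => 1) rfl hid (fun _ => le_rfl) (by rw [hsame, hG])
  refine ⟨i, h1, one_le_logb hn, h3, fun u v huv => h5.2 u v huv rfl, fun v => ?_⟩
  have h6 := h5.1 v
  rw [one_mul] at h6
  refine ⟨Nat.one_le_of_lt h6.1, le_trans ?_ h2⟩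
  exact_mod_cast h6.2

/-! ### The exponent of the number of colors, and the conclusion -/

/-- The exponent of the number of colors exceeds `1` by at most this number. -/
def excess (K : ℝ) (p a : ℕ) : ℝ := Real.log K * (1 / Real.log (p / K) + 1 / Real.log a)

theorem tendsto_excess {K : ℝ} (hK : 0 < K) {p : ℕ → ℕ} (hp : Tendsto p atTop atTop) :
    Tendsto (fun a => excess K (p a) a) atTop (𝓝 0) := by
  have h1 : Tendsto (fun a : ℕ => 1 / Real.log a) atTop (𝓝 0) := by
    simp only [one_div]
    exact (Real.tendsto_log_atTop.comp tendsto_natCast_atTop_atTop).inv_tendsto_atTop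
  have h2 : Tendsto (fun a : ℕ => 1 / Real.log (p a / K)) atTop (𝓝 0) := by
    simp only [one_div]
    exact (Real.tendsto_log_atTop.comp
      ((tendsto_natCast_atTop_atTop.comp hp).atTop_div_const hK)).inv_tendsto_atTop
  simpa [excess] using (h2.add h1).const_mul (Real.log K)

/-- Taking logarithms in `hi` gives `i ≤ log a / log (p / K)`, and `excess` is the resulting bound
for `(i + 1) log K`, divided by `log a`. -/
theorem pow_mul_le_rpow_excess {K : ℝ} (hK : 1 ≤ K) {p a i : ℕ} (hp : K < p) (ha : 2 ≤ a)
    (hi : ((p : ℝ) / K) ^ i ≤ a) : K ^ (i + 1) * (a : ℝ) ≤ (a : ℝ) ^ (1 + excess K p a) := by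
  have ha0 : (0 : ℝ) < a := by positivity
  have hK0 : 0 < K := by linarith
  have hla : 0 < Real.log a := Real.log_pos (by exact_mod_cast ha)
  have hlp : 0 < Real.log (p / K) := Real.log_pos (by rwa [lt_div_iff₀ hK0, one_mul])
  have h1 : (i : ℝ) * Real.log (p / K) ≤ Real.log a := by
    rw [← Real.log_pow]
    exact Real.log_le_log (by have : (0 : ℝ) < p := by linarith
                              positivity) hi
  rw [Real.rpow_add ha0, Real.rpow_one, mul_comm]
  gcongr
  rw [Real.rpow_def_of_pos ha0, ← Real.rpow_natCast, Real.rpow_def_of_pos hK0]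
  refine Real.exp_le_exp.2 ?_
  have h2 : (i : ℝ) ≤ Real.log a / Real.log (p / K) := by rwa [le_div_iff₀ hlp]
  have h3 : Real.log a * excess K p a = Real.log K * (Real.log a / Real.log (p / K) + 1) := by
    rw [excess]
    field_simp
  rw [h3]
  push_cast
  have h4 : 0 ≤ Real.log K := Real.log_nonneg hK
  gcongr

end Dist

end

/-- The first part says that admissible subroutines exist; the second part bounds the time and the
number of colors of Procedure Legal-Coloring, with the parameter `p = ⌊f(a)^{1/2}⌋`, over any
admissible subroutines. -/
theorem mainTheorem3 (ε : ℝ) (hε : 0 < ε) :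
    (∃ (S : Dist.Subroutines) (c : ℝ), S.Admissible ε c) ∧
    ∀ (S : Dist.Subroutines) (c : ℝ), S.Admissible ε c →
      ∃ C : ℝ, ∀ f : ℕ → ℝ, Tendsto f atTop atTop →
        ∃ g : ℕ → ℝ, Tendsto g atTop (𝓝 0) ∧ ∀ᶠ a : ℕ in atTop,
          ∀ (V : Type) [Fintype V] (G : SimpleGraph V) (ident : V → ℕ),
            Dist.IsIdentity ident → Dist.arboricity G = a →
            ((Dist.legalColoring ε S (Fintype.card V) a ⌊√(f a)⌋₊).rounds : ℝ) ≤
                C * f a * Real.logb 2 a * Real.logb 2 (Fintype.card V) ∧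
            (∀ u v, G.Adj u v →
              (Dist.legalColoring ε S (Fintype.card V) a ⌊√(f a)⌋₊).run G ident u ≠
                (Dist.legalColoring ε S (Fintype.card V) a ⌊√(f a)⌋₊).run G ident v) ∧
            ∀ v, 1 ≤ (Dist.legalColoring ε S (Fintype.card V) a ⌊√(f a)⌋₊).run G ident v ∧
              ((Dist.legalColoring ε S (Fintype.card V) a ⌊√(f a)⌋₊).run G ident v : ℝ) ≤
                (a : ℝ) ^ (1 + g a) := by
  refine ⟨Dist.exists_admissible hε, fun S c hS => ⟨Dist.phaseConst ε c + c, fun f hf => ?_⟩⟩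
  have hp : Tendsto (fun a => ⌊√(f a)⌋₊) atTop atTop :=
    tendsto_nat_floor_atTop.comp (Real.tendsto_sqrt_atTop.comp hf)
  refine ⟨fun a => Dist.excess (3 + ε) ⌊√(f a)⌋₊ a, Dist.tendsto_excess (by linarith) hp, ?_⟩
  -- The threshold `2 * (3 + ε)` for `p` makes each phase at least halve the arboricity bound, so
  -- that the number of phases is at most `Real.logb 2 a`.
  filter_upwards [(tendsto_natCast_atTop_atTop.comp hp).eventually_ge_atTop (2 * (3 + ε)),
    hf.eventually_ge_atTop 0, eventually_ge_atTop 2] with a hpa hfa ha V _ G ident hid hG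
  simp only [Function.comp_apply] at hpa
  set p := ⌊√(f a)⌋₊ with hpdef
  obtain ⟨i, h1, h2, h3, h4, h5⟩ :=
    Dist.run_legalColoring_spec hε hS (p := p) (by linarith) (by omega : 1 ≤ a) G hid hG
  refine ⟨h3.trans ?_, h4, fun v => ⟨(h5 v).1, (h5 v).2.trans
    (Dist.pow_mul_le_rpow_excess (by linarith) (by linarith) ha h1)⟩⟩
  have hc := hS.nonneg
  have hph : 0 ≤ Dist.phaseConst ε c := by
    rw [Dist.phaseConst]
    positivity
  have hpf : (p : ℝ) ^ 2 ≤ f a := by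
    calc (p : ℝ) ^ 2 ≤ √(f a) ^ 2 := by
          gcongr
          exact Nat.floor_le (Real.sqrt_nonneg _)
      _ = f a := Real.sq_sqrt hfa
  have hpf' : (p : ℝ) ≤ f a := (le_self_pow₀ (by linarith) (by norm_num)).trans hpf
  have hla := Dist.one_le_logb ha
  have hi : (i : ℝ) ≤ Real.logb 2 a := by
    rw [Real.le_logb_iff_rpow_le (by norm_num) (by positivity), Real.rpow_natCast]
    refine le_trans ?_ h1
    gcongr
    rw [le_div_iff₀ (by linarith)]
    linarith
  refine mul_le_mul_of_nonneg_right ?_ (by linarith)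
  have e1 : (i : ℝ) * (Dist.phaseConst ε c * p ^ 2) ≤
      Real.logb 2 a * (Dist.phaseConst ε c * f a) := by gcongr
  have e2 : c * (p : ℝ) ≤ c * f a * Real.logb 2 a :=
    (mul_le_mul_of_nonneg_left hpf' hc).trans (le_mul_of_one_le_right (by positivity) hla)
  linarith
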